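/- Let $1<r\le 2$, $\frac1r+\frac1{r'}=1$, and write $\langle x\rangle=(1+|x|^2)^{1/2}$. For tempered distributions $u$ on $\mathbb R^{1+3}=\mathbb R_t\times\mathbb R^3_x$ (complex-valued) whose space-time Fourier transform $\widehat u(\tau,\xi)$ is a function, put $$\|u\|_{H^r_{s,b}}=\big\|\langle\xi\rangle^s\langle|\tau|-|\xi|\rangle^b\,\widehat u(\tau,\xi)\big\|_{L^{r'}_{\tau\xi}},\qquad \|u\|_{X^r_{s,b,\pm}}=\big\|\langle\xi\rangle^s\langle\tau\pm|\xi|\rangle^b\,\widehat u(\tau,\xi)\big\|_{L^{r'}_{\tau\xi}},$$ and let $H^r_{s,b}$, $X^r_{s,b,\pm}$ be the corresponding spaces (the completions of the Schwartz space $\mathcal S(\mathbb R^{1+3})$). For $u=u_++u_-$ with $u_\pm\in X^r_{s,b,\pm}$ put $\|u\|_{X^r_{s,b}}=\|u_+\|_{X^r_{s,b,+}}+\|u_-\|_{X^r_{s,b,-}}$. Lemma. Let $b>\frac1r$, $0\le\alpha_0\le\alpha_1$, $\alpha_0\le\alpha_2$ and $\alpha_1+\alpha_2-\alpha_0\ge\frac2r+b$.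 Then there is a constant $C$, depending only on $r,b,\alpha_0,\alpha_1,\alpha_2$, such that for all $u=u_++u_-$ with $u_\pm\in X^r_{\alpha_1,b,\pm}$ and all $v=v_++v_-$ with $v_\pm\in X^r_{\alpha_2,b,\pm}$ the product $uv$ (the pointwise product for Schwartz functions; in general the distribution whose Fourier transform is, up to normalization, the almost everywhere absolutely convergent convolution of $\widehat u$ and $\widehat v$) exists, belongs to $H^r_{\alpha_0,b}$ and satisfies $$\|uv\|_{H^r_{\alpha_0,b}}\le C\,\|u\|_{X^r_{\alpha_1,b}}\,\|v\|_{X^r_{\alpha_2,b}}.$$ -/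

import Mathlib

open MeasureTheory FourierTransform
open scoped SchwartzMap ENNReal NNReal Convolution

noncomputable section

/-- Space-time `ℝ^{1+3} = ℝ_t × ℝ^3_x` with its Euclidean structure. The same space carries the
frequencies `ζ = (τ, ξ)`, with `τ = ζ.fst` and `ξ = ζ.snd`. -/
abbrev SpaceTime : Type := WithLp 2 (ℝ × EuclideanSpace ℝ (Fin 3))

/-- The Japanese bracket `⟨x⟩ = (1 + |x|^2)^{1/2}`. -/
def japaneseBracket (x : ℝ) : ℝ := Real.sqrt (1 + |x| ^ 2)

/-- The weight `⟨ξ⟩^s ⟨|τ| - |ξ|⟩^b`. -/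
def waveWeight (s b : ℝ) (ζ : SpaceTime) : ℝ :=
  japaneseBracket ‖ζ.snd‖ ^ s * japaneseBracket (|ζ.fst| - ‖ζ.snd‖) ^ b

/-- The weight `⟨ξ⟩^s ⟨τ + |ξ|⟩^b`. -/
def plusWeight (s b : ℝ) (ζ : SpaceTime) : ℝ :=
  japaneseBracket ‖ζ.snd‖ ^ s * japaneseBracket (ζ.fst + ‖ζ.snd‖) ^ b

/-- The weight `⟨ξ⟩^s ⟨τ - |ξ|⟩^b`. -/
def minusWeight (s b : ℝ) (ζ : SpaceTime) : ℝ :=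
  japaneseBracket ‖ζ.snd‖ ^ s * japaneseBracket (ζ.fst - ‖ζ.snd‖) ^ b

/-- The space-time Fourier transform of the tempered distribution `u` is (the distribution given
by) the function `f`. Such an `f` is unique up to null sets. -/
structure HasFourierFunction (u : 𝓢'(SpaceTime, ℂ)) (f : SpaceTime → ℂ) : Prop where
  aestronglyMeasurable : AEStronglyMeasurable f volume
  integrable : ∀ φ : 𝓢(SpaceTime, ℂ), Integrable (fun ζ => φ ζ * f ζ) volume
  eq_integral : ∀ φ : 𝓢(SpaceTime, ℂ), (𝓕 u : 𝓢'(SpaceTime, ℂ)) φ = ∫ ζ, φ ζ * f ζ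

/-- The weighted Fourier-Lebesgue norm `‖w û‖_{L^{r'}}` with `1/r + 1/r' = 1`. The infimum
runs over the (almost everywhere equal) functions representing `û`; it is `∞` if `û` is not a
function. For `1 < r`, a weight `w` as above and a tempered distribution `u`, the norm is finite
exactly when `u` lies in the completion of the Schwartz space with respect to it. -/
def fourierLebesgueNorm (r : ℝ) (w : SpaceTime → ℝ) (u : 𝓢'(SpaceTime, ℂ)) : ℝ≥0∞ :=
  ⨅ (f : SpaceTime → ℂ) (_ : HasFourierFunction u f),
    eLpNorm (fun ζ => (w ζ : ℂ) * f ζ) (ENNReal.ofReal (Real.conjExponent r)) volume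

/-- The norm of the wave-Sobolev space `H^r_{s,b}`. -/
def waveNorm (r s b : ℝ) (u : 𝓢'(SpaceTime, ℂ)) : ℝ≥0∞ :=
  fourierLebesgueNorm r (waveWeight s b) u

/-- The norm of `X^r_{s,b,+}`. -/
def xPlusNorm (r s b : ℝ) (u : 𝓢'(SpaceTime, ℂ)) : ℝ≥0∞ :=
  fourierLebesgueNorm r (plusWeight s b) u

/-- The norm of `X^r_{s,b,-}`. -/
def xMinusNorm (r s b : ℝ) (u : 𝓢'(SpaceTime, ℂ)) : ℝ≥0∞ :=
  fourierLebesgueNorm r (minusWeight s b) u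

/-- The quantity `‖u‖_{X^r_{s,b}} = ‖u₊‖_{X^r_{s,b,+}} + ‖u₋‖_{X^r_{s,b,-}}` attached to a
decomposition `u = u₊ + u₋`. -/
def xNorm (r s b : ℝ) (uPlus uMinus : 𝓢'(SpaceTime, ℂ)) : ℝ≥0∞ :=
  xPlusNorm r s b uPlus + xMinusNorm r s b uMinus

/-- The tempered distribution `w` is the product `uv`: the Fourier transforms of `u` and `v` are
functions, and that of `w` is their (almost everywhere absolutely convergent) convolution.
This determines `w`, and for Schwartz functions it is the pointwise product. -/
def IsProduct (u v w : 𝓢'(SpaceTime, ℂ)) : Prop :=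
  ∃ f g : SpaceTime → ℂ, HasFourierFunction u f ∧ HasFourierFunction v g ∧
    (∀ᵐ ζ, ConvolutionExistsAt f g ζ (ContinuousLinearMap.mul ℂ ℂ) volume) ∧
    HasFourierFunction w (f ⋆[ContinuousLinearMap.mul ℂ ℂ, volume] g)

end

/-! On the Fourier side the product is a convolution. Hölder's inequality with exponents `r`, `r'`
in the convolution variable, followed by Tonelli, reduces the estimate for each pair of signs to a
bound, uniform in almost every ζ = (τ, ξ), on the integral over η = (t, x) of the `r`-th power of
the weight ratio (`lintegral_weight_ratio_le`). Put p = br > 1, R = |ξ|, μ = ε₁|x| + ε₂|ξ - x| and B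
= ||μ| - R|. The elliptic weights contribute at most a multiple of ⟨x⟩^{-(2+p)} + ⟨ξ-x⟩^{-(2+p)}.
The output modulation ⟨|τ| - R⟩ is at most the sum of the two input modulations and B. When an input
modulation dominates, the t-integral of the other one converges, and so does the x-integral, as 2 +
p > 3. When B dominates, the t-integral leaves B^p ⟨τ+μ⟩^{-p} (`lintegral_bracket_resonance_le`). In
bipolar coordinates ρ = |x|, t = |ξ - x| the measure is (2π/R) ρ t dρ dt. On each ellipse or
hyperbola μ = σ the ρ-integral is O(R) (`lintegral_level_curve_le`), which cancels 1/R, and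
⟨τ+σ⟩^{-p} is integrable in σ. -/

/-! ### Bipolar coordinates in three dimensions. -/

open Set in
theorem lintegral_prod_radial {g : ℝ → ℝ≥0∞} (hg : Measurable g) :
    ∫⁻ p : ℝ × ℝ, g (√(p.1 ^ 2 + p.2 ^ 2)) =
      ENNReal.ofReal (2 * Real.pi) * ∫⁻ s in Ioi (0 : ℝ), ENNReal.ofReal s * g s := by
  rw [← lintegral_comp_polarCoord_symm]
  have h : ∀ p ∈ polarCoord.target, ENNReal.ofReal p.1 •
      g (√((polarCoord.symm p).1 ^ 2 + (polarCoord.symm p).2 ^ 2)) =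
      ENNReal.ofReal p.1 * g p.1 := by
    intro p hp
    rw [polarCoord_target] at hp
    have hp1 : 0 < p.1 := hp.1
    rw [polarCoord_symm_apply, smul_eq_mul]
    simp only
    rw [show (p.1 * Real.cos p.2) ^ 2 + (p.1 * Real.sin p.2) ^ 2 = p.1 ^ 2 by
      linear_combination p.1 ^ 2 * Real.sin_sq_add_cos_sq p.2, Real.sqrt_sq hp1.le]
  rw [setLIntegral_congr_fun polarCoord.open_target.measurableSet h, polarCoord_target,
    Measure.volume_eq_prod, ← Measure.prod_restrict, lintegral_prod _ (by fun_prop)]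
  simp only [lintegral_const, Measure.restrict_apply MeasurableSet.univ, univ_inter,
    Real.volume_Ioo]
  rw [lintegral_mul_const _ (by fun_prop), mul_comm]
  congr 2
  ring

theorem measurePreserving_euclideanThree :
    MeasurePreserving (fun x : EuclideanSpace ℝ (Fin 3) => (x 0, x 1, x 2)) := by
  have h1 := PiLp.volume_preserving_ofLp (Fin 3)
  have h2 := volume_preserving_piFinSuccAbove (fun _ : Fin 3 => ℝ) 0
  have h3 := (MeasurePreserving.id (volume : Measure ℝ)).prod (volume_preserving_finTwoArrow ℝ)
  exact h3.comp (h2.comp h1)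

-- Substitution ρ = √(x² + s²), with ρ dρ = s ds. Only the inclusion of the image in the half-line
-- is used, hence the inequality.
open Set in
theorem lintegral_sqrt_add_sq_le (x : ℝ) (g : ℝ → ℝ≥0∞) :
    ∫⁻ s in Ioi (0 : ℝ), ENNReal.ofReal s * g (√(x ^ 2 + s ^ 2)) ≤
      ∫⁻ ρ in Ioi |x|, ENNReal.ofReal ρ * g ρ := by
  have hpos : ∀ s ∈ Ioi (0 : ℝ), 0 < x ^ 2 + s ^ 2 := fun s hs => by
    have : 0 < s := hs
    positivity
  have hinj : InjOn (fun s => √(x ^ 2 + s ^ 2)) (Ioi 0) := by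
    intro s hs t ht h
    have hs' : 0 < s := hs
    have ht' : 0 < t := ht
    have := (Real.sqrt_inj (hpos s hs).le (hpos t ht).le).1 h
    exact (pow_left_inj₀ hs'.le ht'.le two_ne_zero).1 (by linarith)
  have hder : ∀ s ∈ Ioi (0 : ℝ), HasDerivWithinAt (fun s => √(x ^ 2 + s ^ 2))
      (s / √(x ^ 2 + s ^ 2)) (Ioi 0) s := by
    intro s hs
    have := ((((hasDerivAt_id s).pow 2).const_add (x ^ 2)).sqrt (hpos s hs).ne').hasDerivWithinAt
      (s := Ioi 0)
    refine this.congr_deriv ?_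
    simp
    field_simp
  have key := lintegral_image_eq_lintegral_abs_deriv_mul measurableSet_Ioi hder hinj
    (fun ρ => ENNReal.ofReal ρ * g ρ)
  calc _ = ∫⁻ s in Ioi (0 : ℝ), ENNReal.ofReal |s / √(x ^ 2 + s ^ 2)| *
        (ENNReal.ofReal √(x ^ 2 + s ^ 2) * g √(x ^ 2 + s ^ 2)) := by
        refine setLIntegral_congr_fun measurableSet_Ioi fun s hs => ?_
        have hs' : 0 < s := hs
        have := Real.sqrt_pos.2 (hpos s hs)
        rw [← mul_assoc, ← ENNReal.ofReal_mul (abs_nonneg _), abs_of_pos (by positivity),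
          div_mul_cancel₀ _ this.ne']
    _ = _ := key.symm
    _ ≤ _ := by
        refine lintegral_mono_set ?_
        rintro _ ⟨s, hs, rfl⟩
        have hs' : 0 < s := hs
        rw [mem_Ioi, ← Real.sqrt_sq_eq_abs]
        exact Real.sqrt_lt_sqrt (sq_nonneg x) (by nlinarith)

-- For y on the sphere of radius ρ, with component x along a vector of length R, the distance t to
-- that vector satisfies t² = R² - 2Rx + ρ², so t dt = -R dx. This is the source of the factor 1/R.
open Set in
theorem lintegral_sqrt_linear_le {R ρ : ℝ} (hR : 0 < R) (hρ : 0 < ρ) (g : ℝ → ℝ≥0∞) :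
    ∫⁻ x in Ioo (-ρ) ρ, g (√(R ^ 2 - 2 * R * x + ρ ^ 2)) ≤
      ENNReal.ofReal (1 / R) * ∫⁻ t in Ioo |ρ - R| (ρ + R), ENNReal.ofReal t * g t := by
  have hlo : ∀ x ∈ Ioo (-ρ) ρ, |ρ - R| ^ 2 < R ^ 2 - 2 * R * x + ρ ^ 2 := fun x hx => by
    rw [sq_abs]
    nlinarith [mul_lt_mul_of_pos_left hx.2 hR]
  have hhi : ∀ x ∈ Ioo (-ρ) ρ, R ^ 2 - 2 * R * x + ρ ^ 2 < (ρ + R) ^ 2 := fun x hx => by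
    nlinarith [mul_lt_mul_of_pos_left hx.1 hR]
  have hpos : ∀ x ∈ Ioo (-ρ) ρ, 0 < R ^ 2 - 2 * R * x + ρ ^ 2 := fun x hx =>
    (sq_nonneg _).trans_lt (hlo x hx)
  have hinj : InjOn (fun x => √(R ^ 2 - 2 * R * x + ρ ^ 2)) (Ioo (-ρ) ρ) := by
    intro s hs t ht h
    have := (Real.sqrt_inj (hpos s hs).le (hpos t ht).le).1 h
    exact mul_left_cancel₀ hR.ne' (by linarith)
  have hder : ∀ x ∈ Ioo (-ρ) ρ, HasDerivWithinAt (fun x => √(R ^ 2 - 2 * R * x + ρ ^ 2))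
      (-R / √(R ^ 2 - 2 * R * x + ρ ^ 2)) (Ioo (-ρ) ρ) x := by
    intro x hx
    have := (((((hasDerivAt_id x).const_mul (2 * R)).const_sub (R ^ 2)).add_const
      (ρ ^ 2)).sqrt (hpos x hx).ne').hasDerivWithinAt (s := Ioo (-ρ) ρ)
    refine this.congr_deriv ?_
    simp
    field_simp
  have key := lintegral_image_eq_lintegral_abs_deriv_mul measurableSet_Ioo hder hinj
    (fun t => ENNReal.ofReal t * g t)
  calc _ = ∫⁻ x in Ioo (-ρ) ρ, ENNReal.ofReal (1 / R) *
        (ENNReal.ofReal |-R / √(R ^ 2 - 2 * R * x + ρ ^ 2)| *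
        (ENNReal.ofReal √(R ^ 2 - 2 * R * x + ρ ^ 2) * g √(R ^ 2 - 2 * R * x + ρ ^ 2))) := by
        refine setLIntegral_congr_fun measurableSet_Ioo fun x hx => ?_
        have := Real.sqrt_pos.2 (hpos x hx)
        rw [← mul_assoc, ← mul_assoc, ← ENNReal.ofReal_mul (by positivity),
          ← ENNReal.ofReal_mul (by positivity), abs_div, abs_neg, abs_of_pos hR, abs_of_pos this]
        rw [show 1 / R * (R / √(R ^ 2 - 2 * R * x + ρ ^ 2)) * √(R ^ 2 - 2 * R * x + ρ ^ 2) = 1 by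
          rw [mul_assoc, div_mul_cancel₀ _ this.ne', one_div_mul_cancel hR.ne']]
        simp
    _ = ENNReal.ofReal (1 / R) * _ := by
        rw [lintegral_const_mul' _ _ ENNReal.ofReal_ne_top, ← key]
    _ ≤ _ := by
        gcongr
        rintro _ ⟨x, hx, rfl⟩
        exact ⟨Real.lt_sqrt_of_sq_lt (hlo x hx),
          (Real.sqrt_lt' (by positivity)).2 (hhi x hx)⟩

open Set in
/-- Bipolar coordinates: the integral of a function of the distances to two points of `ℝ^3`. -/
theorem lintegral_bipolar_le {f : ℝ × ℝ → ℝ≥0∞} (hf : Measurable f)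
    {ξ : EuclideanSpace ℝ (Fin 3)} (hξ : ξ ≠ 0) :
    ∫⁻ x, f (‖x‖, ‖ξ - x‖) ≤ ENNReal.ofReal (2 * Real.pi / ‖ξ‖) *
      ∫⁻ ρ in Ioi (0 : ℝ), ENNReal.ofReal ρ *
        ∫⁻ t in Ioo |ρ - ‖ξ‖| (ρ + ‖ξ‖), ENNReal.ofReal t * f (ρ, t) := by
  set R := ‖ξ‖ with hRdef
  have hR : 0 < R := norm_pos_iff.2 hξ
  have hnorm : ∀ y : EuclideanSpace ℝ (Fin 3), ‖y‖ = √(y 0 ^ 2 + (y 1 ^ 2 + y 2 ^ 2)) := by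
    intro y
    rw [EuclideanSpace.norm_eq, Fin.sum_univ_three]
    simp [add_assoc]
  let e : EuclideanSpace ℝ (Fin 3) := EuclideanSpace.single 0 R
  have he : ‖ξ‖ = ‖e‖ := by simp [e, hRdef]
  -- This reflection moves ξ onto the first axis, so that coordinate 0 becomes the axial variable.
  let A := (ℝ ∙ (ξ - e))ᗮ.reflection
  have hA : A ξ = e := Submodule.reflection_sub he
  let G : ℝ → ℝ → ℝ≥0∞ := fun x ρ => f (ρ, √(R ^ 2 - 2 * R * x + ρ ^ 2))
  have hG : Measurable (Function.uncurry G) := by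
    refine hf.comp ?_
    fun_prop
  calc ∫⁻ x, f (‖x‖, ‖ξ - x‖) = ∫⁻ x, f (‖A x‖, ‖e - A x‖) := by
        simp_rw [← hA, ← map_sub, LinearIsometryEquiv.norm_map]
    _ = ∫⁻ y, f (‖y‖, ‖e - y‖) :=
        A.measurePreserving.lintegral_comp (f := fun y => f (‖y‖, ‖e - y‖)) (by fun_prop)
    _ = ∫⁻ y : EuclideanSpace ℝ (Fin 3), (fun p : ℝ × ℝ × ℝ =>
          G p.1 (√(p.1 ^ 2 + √(p.2.1 ^ 2 + p.2.2 ^ 2) ^ 2))) (y 0, y 1, y 2) := by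
        refine lintegral_congr fun y => ?_
        simp only [G]
        rw [Real.sq_sqrt (by positivity), Real.sq_sqrt (by positivity), hnorm, hnorm]
        simp only [e, PiLp.sub_apply, PiLp.single_apply]
        congr 3
        simp
        ring
    _ = ∫⁻ x : ℝ, ∫⁻ p : ℝ × ℝ, G x (√(x ^ 2 + √(p.1 ^ 2 + p.2 ^ 2) ^ 2)) := by
        have hm : Measurable (fun p : ℝ × ℝ × ℝ =>
          G p.1 (√(p.1 ^ 2 + √(p.2.1 ^ 2 + p.2.2 ^ 2) ^ 2))) :=
          hG.comp (f := fun p : ℝ × ℝ × ℝ => (p.1, √(p.1 ^ 2 + √(p.2.1 ^ 2 + p.2.2 ^ 2) ^ 2)))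
            (by fun_prop)
        rw [measurePreserving_euclideanThree.lintegral_comp hm, Measure.volume_eq_prod,
          lintegral_prod _ hm.aemeasurable]
    _ = ∫⁻ x : ℝ, ENNReal.ofReal (2 * Real.pi) *
          ∫⁻ s in Ioi (0 : ℝ), ENNReal.ofReal s * G x (√(x ^ 2 + s ^ 2)) := by
        refine lintegral_congr fun x => ?_
        exact lintegral_prod_radial (g := fun s => G x (√(x ^ 2 + s ^ 2)))
          (hG.comp (f := fun s : ℝ => (x, √(x ^ 2 + s ^ 2))) (by fun_prop))
    _ ≤ ∫⁻ x : ℝ, ENNReal.ofReal (2 * Real.pi) *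
          ∫⁻ ρ in Ioi |x|, ENNReal.ofReal ρ * G x ρ := by
        exact lintegral_mono fun x => mul_le_mul' le_rfl (lintegral_sqrt_add_sq_le x (G x))
    _ = ENNReal.ofReal (2 * Real.pi) * ∫⁻ x : ℝ, ∫⁻ ρ : ℝ,
          {p : ℝ × ℝ | |p.1| < p.2}.indicator
            (fun p => ENNReal.ofReal p.2 * G p.1 p.2) (x, ρ) := by
        rw [lintegral_const_mul' _ _ ENNReal.ofReal_ne_top]
        congr 1
        refine lintegral_congr fun x => ?_
        rw [← lintegral_indicator measurableSet_Ioi]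
        rfl
    _ = ENNReal.ofReal (2 * Real.pi) * ∫⁻ ρ : ℝ, ∫⁻ x : ℝ,
          {p : ℝ × ℝ | |p.1| < p.2}.indicator
            (fun p => ENNReal.ofReal p.2 * G p.1 p.2) (x, ρ) := by
        rw [lintegral_lintegral_swap]
        refine Measurable.aemeasurable ?_
        refine Measurable.indicator ?_ (measurableSet_lt (by fun_prop) (by fun_prop))
        exact (by fun_prop : Measurable fun p : ℝ × ℝ => ENNReal.ofReal p.2).mul hG
    _ = ENNReal.ofReal (2 * Real.pi) * ∫⁻ ρ in Ioi (0 : ℝ),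
          ENNReal.ofReal ρ * ∫⁻ x in Ioo (-ρ) ρ, G x ρ := by
        congr 1
        rw [← lintegral_indicator measurableSet_Ioi]
        refine lintegral_congr fun ρ => ?_
        by_cases hρ : 0 < ρ
        · rw [indicator_of_mem (show ρ ∈ Ioi 0 from hρ),
            ← lintegral_const_mul' _ _ ENNReal.ofReal_ne_top,
            ← lintegral_indicator measurableSet_Ioo]
          refine lintegral_congr fun x => ?_
          simp only [indicator, mem_ofPred_eq, mem_Ioo, abs_lt]
        · rw [indicator_of_notMem (show ρ ∉ Ioi 0 from hρ), lintegral_eq_zero_of_ae_eq_zero]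
          refine Filter.Eventually.of_forall fun x => ?_
          refine indicator_of_notMem ?_ _
          have := abs_nonneg x
          simp only [mem_ofPred_eq, not_lt] at hρ ⊢
          linarith
    _ ≤ ENNReal.ofReal (2 * Real.pi) * ∫⁻ ρ in Ioi (0 : ℝ), ENNReal.ofReal ρ *
          (ENNReal.ofReal (1 / R) * ∫⁻ t in Ioo |ρ - R| (ρ + R), ENNReal.ofReal t * f (ρ, t)) := by
        gcongr 1
        refine setLIntegral_mono' measurableSet_Ioi fun ρ hρ => ?_
        gcongr
        exact lintegral_sqrt_linear_le hR hρ fun t => f (ρ, t)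
    _ = _ := by
        simp_rw [mul_left_comm _ (ENNReal.ofReal (1 / R))]
        rw [lintegral_const_mul' _ _ ENNReal.ofReal_ne_top, ← mul_assoc,
          ← ENNReal.ofReal_mul (by positivity), mul_one_div]

/-! ### The Japanese bracket. -/

theorem japaneseBracket_eq (x : ℝ) : japaneseBracket x = √(1 + x ^ 2) := by
  rw [japaneseBracket, sq_abs]

theorem one_le_japaneseBracket (x : ℝ) : 1 ≤ japaneseBracket x := by
  rw [japaneseBracket_eq, Real.one_le_sqrt]
  nlinarith [sq_nonneg x]

theorem japaneseBracket_pos (x : ℝ) : 0 < japaneseBracket x :=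
  one_pos.trans_le (one_le_japaneseBracket x)

theorem abs_le_japaneseBracket (x : ℝ) : |x| ≤ japaneseBracket x := by
  rw [japaneseBracket_eq]
  exact Real.abs_le_sqrt (by linarith)

@[fun_prop]
theorem continuous_japaneseBracket : Continuous japaneseBracket := by
  unfold japaneseBracket
  fun_prop

@[fun_prop]
theorem measurable_japaneseBracket : Measurable japaneseBracket :=
  continuous_japaneseBracket.measurable

theorem japaneseBracket_le_of_abs_le {x y : ℝ} (h : |x| ≤ |y|) :
    japaneseBracket x ≤ japaneseBracket y := by
  unfold japaneseBracket
  gcongr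

/-- Keeping |y| instead of its bracket lets the resonance B enter as the pure power B^p, the form in
which the level-curve bound is linear in R. -/
theorem japaneseBracket_add_le_abs (x y : ℝ) :
    japaneseBracket (x + y) ≤ japaneseBracket x + |y| := by
  have h1 := japaneseBracket_pos x
  have h2 : japaneseBracket x ^ 2 = 1 + x ^ 2 := by
    rw [japaneseBracket_eq, Real.sq_sqrt (by positivity)]
  have h3 : x * y ≤ japaneseBracket x * |y| := by
    refine (le_abs_self _).trans ?_
    rw [abs_mul]
    gcongr
    exact abs_le_japaneseBracket x
  rw [japaneseBracket_eq (x + y)]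
  refine Real.sqrt_le_iff.2 ⟨by positivity, ?_⟩
  nlinarith [sq_abs y]

theorem japaneseBracket_add_le (x y : ℝ) :
    japaneseBracket (x + y) ≤ japaneseBracket x + japaneseBracket y :=
  (japaneseBracket_add_le_abs x y).trans (by gcongr; exact abs_le_japaneseBracket y)

theorem lintegral_japaneseBracket_norm_lt_top {E : Type*} [NormedAddCommGroup E]
    [NormedSpace ℝ E] [FiniteDimensional ℝ E] [MeasurableSpace E] [BorelSpace E]
    (μ : Measure E) [μ.IsAddHaarMeasure] {q : ℝ} (hq : (Module.finrank ℝ E : ℝ) < q) :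
    ∫⁻ x, ENNReal.ofReal (japaneseBracket ‖x‖ ^ (-q)) ∂μ < ∞ := by
  have h := (integrable_rpow_neg_one_add_norm_sq (μ := μ) hq).lintegral_lt_top
  refine lt_of_eq_of_lt (lintegral_congr fun x => ?_) h
  rw [japaneseBracket_eq, Real.sqrt_eq_rpow, ← Real.rpow_mul (by positivity)]
  ring_nf

theorem lintegral_japaneseBracket_lt_top {p : ℝ} (hp : 1 < p) :
    ∫⁻ x, ENNReal.ofReal (japaneseBracket x ^ (-p)) < ∞ := by
  refine lt_of_eq_of_lt (lintegral_congr fun x => ?_)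
    (lintegral_japaneseBracket_norm_lt_top (volume : Measure ℝ) (q := p) (by simpa using hp))
  rw [japaneseBracket_eq, japaneseBracket_eq, Real.norm_eq_abs, sq_abs]

/-! ### Integration along the level curves of the resonance function. -/

open Set in
theorem lintegral_rpow_tail {s c : ℝ} (hs : 1 < s) (hc : 0 < c) :
    ∫⁻ ρ in Ioi c, ENNReal.ofReal (ρ ^ (-s)) = ENNReal.ofReal (c ^ (1 - s) / (s - 1)) := by
  rw [← ofReal_integral_eq_lintegral_ofReal (integrableOn_Ioi_rpow_of_lt (by linarith) hc)
    ((ae_restrict_mem measurableSet_Ioi).mono fun x hx =>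
      Real.rpow_nonneg (hc.trans hx).le _), integral_Ioi_rpow_of_lt (by linarith) hc]
  congr 1
  rw [← neg_div_neg_eq]
  ring_nf

open Set in
/-- One-dimensional estimate on the level curves `ε₁ ρ + ε₂ t = σ` in bipolar coordinates. -/
theorem lintegral_level_curve_le {p R ε₁ ε₂ : ℝ} (hp : 1 < p) (hR : 0 < R)
    (h₁ : ε₁ = 1 ∨ ε₁ = -1) (h₂ : ε₂ = 1 ∨ ε₂ = -1) (σ : ℝ) :
    ∫⁻ ρ, {ρ : ℝ | 0 < ρ ∧ |ρ - R| < ε₂ * (σ - ε₁ * ρ) ∧ ε₂ * (σ - ε₁ * ρ) < ρ + R}.indicator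
      (fun ρ => ENNReal.ofReal (ρ * (ε₂ * (σ - ε₁ * ρ)) *
        (japaneseBracket ρ ^ (-(2 + p)) * |(|σ| - R)| ^ p))) ρ ≤
      ENNReal.ofReal ((2 ^ p + 2 ^ p / (p - 1) + 2 ^ p / p) * R) := by
  set B := |(|σ| - R)| with hBdef
  set T := {ρ : ℝ | 0 < ρ ∧ |ρ - R| < ε₂ * (σ - ε₁ * ρ) ∧ ε₂ * (σ - ε₁ * ρ) < ρ + R} with hT
  rcases (abs_nonneg (|σ| - R)).eq_or_lt with hB0 | hB
  · rw [lintegral_eq_zero_of_ae_eq_zero]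
    · exact zero_le
    · refine Filter.Eventually.of_forall fun ρ => ?_
      rw [hBdef, ← hB0, Real.zero_rpow (by linarith)]
      simp
  rw [← hBdef] at hB
  have hp0 : 0 < p - 1 := by linarith
  -- the two geometric alternatives on the level curve
  have geo : ∀ ρ ∈ T, B < 2 * ρ ∧
      (B ≤ R ∨ ((|σ| - R) / 2 < ρ ∧ ρ < (|σ| + R) / 2)) := by
    rintro ρ ⟨hρ, ha, hb⟩
    rw [abs_lt] at ha
    rw [hBdef]
    -- With t = ε₂(σ - ε₁ρ), equal signs give an ellipse: |σ| = ρ + t and B = |σ| - R. Opposite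
    -- signs give a hyperbola: |σ| = |ρ - t| < R and B = R - |σ| ≤ R.
    rcases h₁ with rfl | rfl <;> rcases h₂ with rfl | rfl
    · have hs : |σ| = σ := abs_of_pos (by linarith)
      rw [hs]
      exact ⟨by rw [abs_lt]; constructor <;> linarith, Or.inr ⟨by linarith, by linarith⟩⟩
    · have hs : |σ| < R := by rw [abs_lt]; constructor <;> linarith
      rw [abs_of_neg (by linarith)]
      exact ⟨by linarith [neg_abs_le σ, le_abs_self σ], Or.inl (by linarith [abs_nonneg σ])⟩
    · have hs : |σ| < R := by rw [abs_lt]; constructor <;> linarith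
      rw [abs_of_neg (by linarith)]
      exact ⟨by linarith [neg_abs_le σ, le_abs_self σ], Or.inl (by linarith [abs_nonneg σ])⟩
    · have hs : |σ| = -σ := abs_of_neg (by linarith)
      rw [hs]
      exact ⟨by rw [abs_lt]; constructor <;> linarith, Or.inr ⟨by linarith, by linarith⟩⟩
  -- Uses t < ρ + R and ⟨ρ⟩ ≥ ρ. The singularity at ρ = 0 is harmless because ρ > B/2 on the curve.
  have bound : ∀ ρ ∈ T, ρ * (ε₂ * (σ - ε₁ * ρ)) * (japaneseBracket ρ ^ (-(2 + p)) * B ^ p) ≤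
      B ^ p * ρ ^ (-p) + R * B ^ p * ρ ^ (-(1 + p)) := by
    rintro ρ ⟨hρ, ha, hb⟩
    have hJ : japaneseBracket ρ ^ (-(2 + p)) ≤ ρ ^ (-(2 + p)) :=
      Real.rpow_le_rpow_of_nonpos hρ ((le_abs_self ρ).trans (abs_le_japaneseBracket ρ))
        (by linarith)
    have e1 : ρ ^ (-p) = ρ ^ 2 * ρ ^ (-(2 + p)) := by
      rw [← Real.rpow_natCast, ← Real.rpow_add hρ]
      congr 1
      push_cast
      ring
    have e2 : ρ ^ (-(1 + p)) = ρ * ρ ^ (-(2 + p)) := by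
      conv_rhs => rw [← Real.rpow_one_add' hρ.le (by linarith)]
      congr 1
      ring
    have := (abs_nonneg (ρ - R)).trans_lt ha
    have := japaneseBracket_pos ρ
    calc _ ≤ ρ * (ρ + R) * (ρ ^ (-(2 + p)) * B ^ p) := by gcongr
      _ = _ := by rw [e1, e2]; ring
  have tail1 : ∫⁻ ρ in Ioi (B / 2), ENNReal.ofReal (R * B ^ p * ρ ^ (-(1 + p))) ≤
      ENNReal.ofReal (2 ^ p / p * R) := by
    simp_rw [ENNReal.ofReal_mul (by positivity : 0 ≤ R * B ^ p)]
    rw [lintegral_const_mul' _ _ ENNReal.ofReal_ne_top, lintegral_rpow_tail (by linarith)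
      (by positivity), ← ENNReal.ofReal_mul (by positivity)]
    refine ENNReal.ofReal_le_ofReal (le_of_eq ?_)
    rw [show 1 - (1 + p) = -p by ring, Real.rpow_neg (by positivity),
      Real.div_rpow hB.le zero_le_two]
    have : 0 < B ^ p := by positivity
    have : 0 < p := by linarith
    rw [show 1 + p - 1 = p by ring]
    field_simp
  -- This tail is proportional to B, not R, so it suffices only when B ≤ R.
  have tail2 : ∫⁻ ρ in Ioi (B / 2), ENNReal.ofReal (B ^ p * ρ ^ (-p)) ≤
      ENNReal.ofReal (2 ^ p / (p - 1) * B) := by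
    simp_rw [ENNReal.ofReal_mul (by positivity : 0 ≤ B ^ p)]
    rw [lintegral_const_mul' _ _ ENNReal.ofReal_ne_top, lintegral_rpow_tail (by linarith)
      (by positivity), ← ENNReal.ofReal_mul (by positivity)]
    refine ENNReal.ofReal_le_ofReal ?_
    rw [Real.rpow_sub (by positivity), Real.rpow_one, Real.div_rpow hB.le zero_le_two]
    have : 0 < B ^ p := by positivity
    have : (0 : ℝ) < 2 ^ p := by positivity
    rw [show B ^ p * (B / 2 / (B ^ p / 2 ^ p) / (p - 1)) = 2 ^ p / (p - 1) * B / 2 by field_simp]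
    have : 0 < 2 ^ p / (p - 1) * B := by positivity
    linarith
  set k : ℝ → ℝ≥0∞ := fun ρ => ENNReal.ofReal (R * B ^ p * ρ ^ (-(1 + p))) with hk
  have hkm : Measurable ((Ioi (B / 2)).indicator k) := by
    refine Measurable.indicator ?_ measurableSet_Ioi
    fun_prop
  by_cases hBR : B ≤ R
  · set l : ℝ → ℝ≥0∞ := fun ρ => ENNReal.ofReal (B ^ p * ρ ^ (-p)) with hl
    calc _ ≤ ∫⁻ ρ, (Ioi (B / 2)).indicator l ρ + (Ioi (B / 2)).indicator k ρ := by
          refine lintegral_mono fun ρ => ?_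
          by_cases hρ : ρ ∈ T
          · have hmem : ρ ∈ Ioi (B / 2) := by
              rw [mem_Ioi]
              linarith [(geo ρ hρ).1]
            have hρ0 : 0 < ρ := hρ.1
            rw [indicator_of_mem hρ, indicator_of_mem hmem, indicator_of_mem hmem, hl, hk,
              ← ENNReal.ofReal_add (by positivity) (by positivity)]
            exact ENNReal.ofReal_le_ofReal (bound ρ hρ)
          · rw [indicator_of_notMem hρ]
            exact zero_le
      _ = (∫⁻ ρ in Ioi (B / 2), l ρ) + ∫⁻ ρ in Ioi (B / 2), k ρ := by
          rw [lintegral_add_right _ hkm, lintegral_indicator measurableSet_Ioi,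
            lintegral_indicator measurableSet_Ioi]
      _ ≤ ENNReal.ofReal (2 ^ p / (p - 1) * B) + ENNReal.ofReal (2 ^ p / p * R) := by
          gcongr
      _ ≤ _ := by
          rw [← ENNReal.ofReal_add (by positivity) (by positivity)]
          refine ENNReal.ofReal_le_ofReal ?_
          have : 2 ^ p / (p - 1) * B ≤ 2 ^ p / (p - 1) * R := by gcongr
          have : 0 ≤ 2 ^ p * R := by positivity
          linarith
  -- For B > R only the ellipse remains: ρ ranges over an interval of length R, and B < 2ρ bounds
  -- B^p ρ^{-p} by 2^p.
  · calc _ ≤ ∫⁻ ρ, (Ioo ((|σ| - R) / 2) ((|σ| + R) / 2)).indicator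
            (fun _ => ENNReal.ofReal (2 ^ p)) ρ + (Ioi (B / 2)).indicator k ρ := by
          refine lintegral_mono fun ρ => ?_
          by_cases hρ : ρ ∈ T
          · have hg := geo ρ hρ
            have hmem : ρ ∈ Ioi (B / 2) := by
              rw [mem_Ioi]
              linarith [hg.1]
            have hρ0 : 0 < ρ := hρ.1
            rw [indicator_of_mem hρ, indicator_of_mem hmem,
              indicator_of_mem (show ρ ∈ Ioo _ _ from hg.2.resolve_left hBR), hk,
              ← ENNReal.ofReal_add (by positivity) (by positivity)]
            refine ENNReal.ofReal_le_ofReal ((bound ρ hρ).trans ?_)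
            gcongr
            calc B ^ p * ρ ^ (-p) ≤ (2 * ρ) ^ p * ρ ^ (-p) := by
                  gcongr
                  exact hg.1.le
              _ = 2 ^ p := by
                  rw [Real.mul_rpow zero_le_two hρ0.le, mul_assoc, ← Real.rpow_add hρ0]
                  simp
          · rw [indicator_of_notMem hρ]
            exact zero_le
      _ = ENNReal.ofReal (2 ^ p) * ENNReal.ofReal R + ∫⁻ ρ in Ioi (B / 2), k ρ := by
          rw [lintegral_add_right _ hkm, lintegral_indicator measurableSet_Ioi,
            lintegral_indicator measurableSet_Ioo, setLIntegral_const, Real.volume_Ioo]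
          congr 3
          ring
      _ ≤ ENNReal.ofReal (2 ^ p) * ENNReal.ofReal R + ENNReal.ofReal (2 ^ p / p * R) := by
          gcongr
      _ ≤ _ := by
          rw [← ENNReal.ofReal_mul (by positivity), ← ENNReal.ofReal_add (by positivity)
            (by positivity)]
          refine ENNReal.ofReal_le_ofReal ?_
          have : 0 ≤ 2 ^ p / (p - 1) * R := by positivity
          linarith

theorem lintegral_comp_sign_mul_sub (h : ℝ → ℝ≥0∞) {ε : ℝ} (hε : ε = 1 ∨ ε = -1) (a : ℝ) :
    ∫⁻ σ, h (ε * (σ - a)) = ∫⁻ t, h t := by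
  rcases hε with rfl | rfl
  · simpa using lintegral_sub_right_eq_self h a
  · simpa using lintegral_sub_left_eq_self h a

-- The level-curve bound D·R cancels the 1/R of the bipolar measure, and translation invariance of
-- the σ-integral makes the constant independent of τ.
open Set in
theorem lintegral_bracket_resonance_le {p : ℝ} (hp : 1 < p) :
    ∃ C : ℝ≥0∞, C ≠ ∞ ∧ ∀ ε₁ ε₂ : ℝ, (ε₁ = 1 ∨ ε₁ = -1) → (ε₂ = 1 ∨ ε₂ = -1) →
      ∀ (τ : ℝ) (ξ : EuclideanSpace ℝ (Fin 3)), ξ ≠ 0 →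
      ∫⁻ x, ENNReal.ofReal (japaneseBracket ‖x‖ ^ (-(2 + p)) *
        |(|ε₁ * ‖x‖ + ε₂ * ‖ξ - x‖| - ‖ξ‖)| ^ p *
        japaneseBracket (τ + (ε₁ * ‖x‖ + ε₂ * ‖ξ - x‖)) ^ (-p)) ≤ C := by
  set D := 2 ^ p + 2 ^ p / (p - 1) + 2 ^ p / p with hD
  have hD0 : 0 < D := by
    have : 0 < p - 1 := by linarith
    positivity
  set I := ∫⁻ x, ENNReal.ofReal (japaneseBracket x ^ (-p)) with hI
  have hIfin : I < ∞ := lintegral_japaneseBracket_lt_top hp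
  refine ⟨ENNReal.ofReal (2 * Real.pi * D) * I,
    ENNReal.mul_ne_top ENNReal.ofReal_ne_top hIfin.ne, fun ε₁ ε₂ h₁ h₂ τ ξ hξ => ?_⟩
  set R := ‖ξ‖ with hRdef
  have hR : 0 < R := norm_pos_iff.2 hξ
  let f : ℝ × ℝ → ℝ≥0∞ := fun y => ENNReal.ofReal (japaneseBracket y.1 ^ (-(2 + p)) *
    |(|ε₁ * y.1 + ε₂ * y.2| - R)| ^ p * japaneseBracket (τ + (ε₁ * y.1 + ε₂ * y.2)) ^ (-p))
  have hf : Measurable f := by fun_prop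
  -- the integrand in the coordinates `(ρ, σ)`, `σ = ε₁ ρ + ε₂ t`
  let S : Set (ℝ × ℝ) := {y | 0 < y.1 ∧ |y.1 - R| < ε₂ * (y.2 - ε₁ * y.1) ∧
    ε₂ * (y.2 - ε₁ * y.1) < y.1 + R}
  have hS : MeasurableSet S := by
    refine MeasurableSet.inter (s₁ := {y : ℝ × ℝ | 0 < y.1})
      (measurableSet_lt (by fun_prop) (by fun_prop)) ?_
    refine MeasurableSet.inter (s₁ := {y : ℝ × ℝ | |y.1 - R| < ε₂ * (y.2 - ε₁ * y.1)})
      (s₂ := {y : ℝ × ℝ | ε₂ * (y.2 - ε₁ * y.1) < y.1 + R}) ?_ ?_ <;>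
    exact measurableSet_lt (by fun_prop) (by fun_prop)
  let H : ℝ × ℝ → ℝ≥0∞ := fun y => S.indicator (fun y => ENNReal.ofReal
    (y.1 * (ε₂ * (y.2 - ε₁ * y.1)) * (japaneseBracket y.1 ^ (-(2 + p)) * |(|y.2| - R)| ^ p))) y *
      ENNReal.ofReal (japaneseBracket (τ + y.2) ^ (-p))
  have hH : Measurable H := by
    refine Measurable.mul (Measurable.indicator ?_ hS) ?_ <;> fun_prop
  have hsq : ε₂ * ε₂ = 1 := by rcases h₂ with rfl | rfl <;> norm_num
  calc _ = ∫⁻ x, f (‖x‖, ‖ξ - x‖) := rfl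
    _ ≤ ENNReal.ofReal (2 * Real.pi / R) * ∫⁻ ρ in Ioi (0 : ℝ), ENNReal.ofReal ρ *
        ∫⁻ t in Ioo |ρ - R| (ρ + R), ENNReal.ofReal t * f (ρ, t) := lintegral_bipolar_le hf hξ
    _ = ENNReal.ofReal (2 * Real.pi / R) * ∫⁻ ρ, ∫⁻ σ, H (ρ, σ) := by
        congr 1
        rw [← lintegral_indicator measurableSet_Ioi]
        refine lintegral_congr fun ρ => ?_
        by_cases hρ : 0 < ρ
        · rw [indicator_of_mem (show ρ ∈ Ioi 0 from hρ), ← lintegral_indicator measurableSet_Ioo,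
            ← lintegral_comp_sign_mul_sub _ h₂ (ε₁ * ρ),
            ← lintegral_const_mul' _ _ ENNReal.ofReal_ne_top]
          refine lintegral_congr fun σ => ?_
          by_cases hσ : (ρ, σ) ∈ S
          · have hm : ε₂ * (σ - ε₁ * ρ) ∈ Ioo |ρ - R| (ρ + R) := hσ.2
            have ht : 0 < ε₂ * (σ - ε₁ * ρ) := (abs_nonneg _).trans_lt hm.1
            have hs : ε₁ * ρ + ε₂ * (ε₂ * (σ - ε₁ * ρ)) = σ := by
              rw [← mul_assoc, hsq]; ring
            simp only [H, f, indicator_of_mem hσ, indicator_of_mem hm, hs]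
            have := japaneseBracket_pos ρ
            rw [← ENNReal.ofReal_mul ht.le, ← ENNReal.ofReal_mul hρ.le,
              ← ENNReal.ofReal_mul (by positivity)]
            congr 1
            ring
          · have hm : ε₂ * (σ - ε₁ * ρ) ∉ Ioo |ρ - R| (ρ + R) := fun h => hσ ⟨hρ, h⟩
            simp only [H, indicator_of_notMem hσ, indicator_of_notMem hm, mul_zero, zero_mul]
        · rw [indicator_of_notMem (show ρ ∉ Ioi 0 from hρ)]
          symm
          refine lintegral_eq_zero_of_ae_eq_zero (Filter.Eventually.of_forall fun σ => ?_)
          have : (ρ, σ) ∉ S := fun h => hρ h.1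
          simp only [H, indicator_of_notMem this, zero_mul, Pi.zero_apply]
    -- With σ outermost, the factor ⟨τ+σ⟩^{-p} is constant along each level curve.
    _ = ENNReal.ofReal (2 * Real.pi / R) * ∫⁻ σ, ∫⁻ ρ, H (ρ, σ) := by
        rw [lintegral_lintegral_swap (f := fun ρ σ => H (ρ, σ)) hH.aemeasurable]
    _ ≤ ENNReal.ofReal (2 * Real.pi / R) * ∫⁻ σ, ENNReal.ofReal (D * R) *
          ENNReal.ofReal (japaneseBracket (τ + σ) ^ (-p)) := by
        refine mul_le_mul' le_rfl (lintegral_mono fun σ => ?_)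
        simp only [H]
        rw [lintegral_mul_const' _ _ ENNReal.ofReal_ne_top]
        exact mul_le_mul' (lintegral_level_curve_le hp hR h₁ h₂ σ) le_rfl
    _ = _ := by
        rw [lintegral_const_mul' _ _ ENNReal.ofReal_ne_top, lintegral_add_left_eq_self
          (fun σ => ENNReal.ofReal (japaneseBracket σ ^ (-p))) τ, ← mul_assoc,
          ← ENNReal.ofReal_mul (by positivity)]
        congr 2
        field_simp

/-! ### Weights and the kernel bound. -/

/-- The weight `⟨ξ⟩^s ⟨τ + ε|ξ|⟩^b`. -/
noncomputable def signedWeight (ε s b : ℝ) (ζ : SpaceTime) : ℝ :=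
  japaneseBracket ‖ζ.snd‖ ^ s * japaneseBracket (ζ.fst + ε * ‖ζ.snd‖) ^ b

theorem plusWeight_eq (s b : ℝ) : plusWeight s b = signedWeight 1 s b := by
  ext ζ
  simp [plusWeight, signedWeight]

theorem minusWeight_eq (s b : ℝ) : minusWeight s b = signedWeight (-1) s b := by
  ext ζ
  simp [minusWeight, signedWeight, sub_eq_add_neg]

theorem signedWeight_pos (ε s b : ℝ) (ζ : SpaceTime) : 0 < signedWeight ε s b ζ :=
  mul_pos (Real.rpow_pos_of_pos (japaneseBracket_pos _) _)
    (Real.rpow_pos_of_pos (japaneseBracket_pos _) _)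

theorem waveWeight_pos (s b : ℝ) (ζ : SpaceTime) : 0 < waveWeight s b ζ :=
  mul_pos (Real.rpow_pos_of_pos (japaneseBracket_pos _) _)
    (Real.rpow_pos_of_pos (japaneseBracket_pos _) _)

theorem one_le_waveWeight {s b : ℝ} (hs : 0 ≤ s) (hb : 0 ≤ b) (ζ : SpaceTime) :
    1 ≤ waveWeight s b ζ :=
  one_le_mul_of_one_le_of_one_le (Real.one_le_rpow (one_le_japaneseBracket _) hs)
    (Real.one_le_rpow (one_le_japaneseBracket _) hb)

@[fun_prop]
theorem measurable_signedWeight (ε s b : ℝ) : Measurable (signedWeight ε s b) := by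
  unfold signedWeight
  fun_prop

@[fun_prop]
theorem measurable_waveWeight (s b : ℝ) : Measurable (waveWeight s b) := by
  unfold waveWeight
  fun_prop

theorem signedWeight_rpow (ε s b r : ℝ) (ζ : SpaceTime) :
    signedWeight ε s b ζ ^ r = signedWeight ε (s * r) (b * r) ζ := by
  have h1 := japaneseBracket_pos ‖ζ.snd‖
  have h2 := japaneseBracket_pos (ζ.fst + ε * ‖ζ.snd‖)
  rw [signedWeight, signedWeight, Real.mul_rpow (by positivity) (by positivity),
    ← Real.rpow_mul h1.le, ← Real.rpow_mul h2.le]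

theorem waveWeight_rpow (s b r : ℝ) (ζ : SpaceTime) :
    waveWeight s b ζ ^ r = waveWeight (s * r) (b * r) ζ := by
  have h1 := japaneseBracket_pos ‖ζ.snd‖
  have h2 := japaneseBracket_pos (|ζ.fst| - ‖ζ.snd‖)
  rw [waveWeight, waveWeight, Real.mul_rpow (by positivity) (by positivity),
    ← Real.rpow_mul h1.le, ← Real.rpow_mul h2.le]

theorem rpow_add_le_two_rpow {x y p : ℝ} (hx : 0 ≤ x) (hy : 0 ≤ y) (hp : 0 ≤ p) :
    (x + y) ^ p ≤ 2 ^ p * (x ^ p + y ^ p) := by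
  wlog h : x ≤ y generalizing x y
  · rw [add_comm, add_comm (x ^ p)]
    exact this hy hx (le_of_not_ge h)
  calc (x + y) ^ p ≤ (2 * y) ^ p := by gcongr; linarith
    _ = 2 ^ p * y ^ p := Real.mul_rpow zero_le_two hy
    _ ≤ _ := by
      gcongr
      linarith [Real.rpow_nonneg hx p]

/-- The larger of x and y absorbs z^{a₀}. Its remaining exponent is nonpositive, so it may be
replaced by the smaller one, which then carries the whole decay. -/
theorem rpow_mul_rpow_neg_le {x y z a₀ a₁ a₂ q : ℝ} (hx : 1 ≤ x) (hy : 1 ≤ y) (hz : 0 ≤ z)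
    (h : z ≤ x + y) (h0 : 0 ≤ a₀) (h01 : a₀ ≤ a₁) (h02 : a₀ ≤ a₂) (hq : q ≤ a₁ + a₂ - a₀) :
    z ^ a₀ * (x ^ (-a₁) * y ^ (-a₂)) ≤ 2 ^ a₀ * (x ^ (-q) + y ^ (-q)) := by
  wlog hxy : x ≤ y generalizing x y a₁ a₂
  · rw [mul_comm (x ^ (-a₁)), add_comm (x ^ (-q))]
    exact this hy hx (by linarith) h02 h01 (by linarith) (le_of_not_ge hxy)
  have hx0 : 0 < x := by linarith
  have hy0 : 0 < y := by linarith
  calc z ^ a₀ * (x ^ (-a₁) * y ^ (-a₂)) ≤ (2 * y) ^ a₀ * (x ^ (-a₁) * y ^ (-a₂)) := by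
        gcongr
        linarith
    _ = 2 ^ a₀ * (x ^ (-a₁) * y ^ (a₀ - a₂)) := by
        rw [Real.mul_rpow zero_le_two hy0.le, sub_eq_add_neg, Real.rpow_add hy0]
        ring
    _ ≤ 2 ^ a₀ * (x ^ (-a₁) * x ^ (a₀ - a₂)) := by
        gcongr ?_ * (_ * ?_)
        exact Real.rpow_le_rpow_of_nonpos hx0 hxy (by linarith)
    _ = 2 ^ a₀ * x ^ (-a₁ + (a₀ - a₂)) := by rw [Real.rpow_add hx0]
    _ ≤ 2 ^ a₀ * x ^ (-q) := by
        refine mul_le_mul_of_nonneg_left (Real.rpow_le_rpow_of_exponent_le hx ?_) (by positivity)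
        linarith
    _ ≤ _ := by
        gcongr
        linarith [Real.rpow_nonneg hy0.le (-q)]

/-- Write |τ| - R = (|τ| - |μ|) + (|μ| - R), where ||τ| - |μ|| ≤ |τ + μ| = |l₁ + l₂|. Each input
modulation in the resulting sum cancels its own negative power. -/
theorem japaneseBracket_sub_rpow_le {τ R μ l₁ l₂ p : ℝ} (hp : 0 ≤ p) (hl : l₁ + l₂ = τ + μ) :
    japaneseBracket (|τ| - R) ^ p * (japaneseBracket l₁ ^ (-p) * japaneseBracket l₂ ^ (-p)) ≤
      4 ^ p * (japaneseBracket l₁ ^ (-p) + japaneseBracket l₂ ^ (-p) +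
        |(|μ| - R)| ^ p * (japaneseBracket l₁ ^ (-p) * japaneseBracket l₂ ^ (-p))) := by
  have h1 := japaneseBracket_pos l₁
  have h2 := japaneseBracket_pos l₂
  set B := |(|μ| - R)| with hB
  have hB0 : 0 ≤ B := abs_nonneg _
  have hle : japaneseBracket (|τ| - R) ≤ (japaneseBracket l₁ + japaneseBracket l₂) + B := by
    have e : |τ| - R = (|τ| - |μ|) + (|μ| - R) := by ring
    rw [e]
    refine (japaneseBracket_add_le_abs _ _).trans ?_
    gcongr
    refine le_trans ?_ (japaneseBracket_add_le l₁ l₂)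
    refine japaneseBracket_le_of_abs_le ?_
    rw [hl]
    simpa using abs_abs_sub_abs_le_abs_sub τ (-μ)
  have hpow : japaneseBracket (|τ| - R) ^ p ≤
      4 ^ p * (japaneseBracket l₁ ^ p + japaneseBracket l₂ ^ p + B ^ p) := by
    calc _ ≤ ((japaneseBracket l₁ + japaneseBracket l₂) + B) ^ p :=
          Real.rpow_le_rpow (japaneseBracket_pos _).le hle hp
      _ ≤ 2 ^ p * ((japaneseBracket l₁ + japaneseBracket l₂) ^ p + B ^ p) :=
          rpow_add_le_two_rpow (by positivity) hB0 hp
      _ ≤ 2 ^ p * (2 ^ p * (japaneseBracket l₁ ^ p + japaneseBracket l₂ ^ p) + 2 ^ p * B ^ p) := by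
          gcongr
          · exact rpow_add_le_two_rpow h1.le h2.le hp
          · exact le_mul_of_one_le_left (by positivity) (Real.one_le_rpow one_le_two hp)
      _ = _ := by
          rw [show (4 : ℝ) = 2 * 2 by norm_num, Real.mul_rpow zero_le_two zero_le_two]
          ring
  have c1 : japaneseBracket l₁ ^ p * japaneseBracket l₁ ^ (-p) = 1 := by
    rw [← Real.rpow_add h1]; simp
  have c2 : japaneseBracket l₂ ^ p * japaneseBracket l₂ ^ (-p) = 1 := by
    rw [← Real.rpow_add h2]; simp
  calc _ ≤ 4 ^ p * (japaneseBracket l₁ ^ p + japaneseBracket l₂ ^ p + B ^ p) *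
        (japaneseBracket l₁ ^ (-p) * japaneseBracket l₂ ^ (-p)) := by gcongr
    _ = _ := by
        linear_combination 4 ^ p * japaneseBracket l₂ ^ (-p) * c1 +
          4 ^ p * japaneseBracket l₁ ^ (-p) * c2

/-- The two arguments sum to d + c, so one of the brackets is at least half of ⟨d + c⟩; the other is
integrated in t. -/
theorem lintegral_bracket_mul_bracket_le {p : ℝ} (hp : 0 ≤ p) (c d : ℝ) :
    ∫⁻ t, ENNReal.ofReal (japaneseBracket (t + c) ^ (-p) * japaneseBracket (d - t) ^ (-p)) ≤
      ENNReal.ofReal (2 ^ p * 2 * japaneseBracket (d + c) ^ (-p)) *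
        ∫⁻ t, ENNReal.ofReal (japaneseBracket t ^ (-p)) := by
  have hpt : ∀ t, japaneseBracket (t + c) ^ (-p) * japaneseBracket (d - t) ^ (-p) ≤
      2 ^ p * japaneseBracket (d + c) ^ (-p) *
        (japaneseBracket (t + c) ^ (-p) + japaneseBracket (d - t) ^ (-p)) := by
    intro t
    have h1 := japaneseBracket_pos (t + c)
    have h2 := japaneseBracket_pos (d - t)
    have h3 := japaneseBracket_pos (d + c)
    have hle : japaneseBracket (d + c) ^ p ≤
        2 ^ p * (japaneseBracket (t + c) ^ p + japaneseBracket (d - t) ^ p) := by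
      refine le_trans (Real.rpow_le_rpow h3.le ?_ hp) (rpow_add_le_two_rpow h1.le h2.le hp)
      refine le_trans (le_of_eq ?_) (japaneseBracket_add_le _ _)
      ring_nf
    simp only [Real.rpow_neg h1.le, Real.rpow_neg h2.le, Real.rpow_neg h3.le]
    have := Real.rpow_pos_of_pos h1 p
    have := Real.rpow_pos_of_pos h2 p
    have := Real.rpow_pos_of_pos h3 p
    rw [← sub_nonneg]
    have e : 2 ^ p * (japaneseBracket (d + c) ^ p)⁻¹ *
        ((japaneseBracket (t + c) ^ p)⁻¹ + (japaneseBracket (d - t) ^ p)⁻¹) -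
        (japaneseBracket (t + c) ^ p)⁻¹ * (japaneseBracket (d - t) ^ p)⁻¹ =
        (2 ^ p * (japaneseBracket (t + c) ^ p + japaneseBracket (d - t) ^ p) -
          japaneseBracket (d + c) ^ p) * ((japaneseBracket (d + c) ^ p)⁻¹ *
        (japaneseBracket (t + c) ^ p)⁻¹ * (japaneseBracket (d - t) ^ p)⁻¹) := by
      field_simp
      ring
    rw [e]
    exact mul_nonneg (sub_nonneg.2 hle) (by positivity)
  have h3 := japaneseBracket_pos (d + c)
  calc _ ≤ ∫⁻ t, ENNReal.ofReal (2 ^ p * japaneseBracket (d + c) ^ (-p)) *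
        (ENNReal.ofReal (japaneseBracket (t + c) ^ (-p)) +
          ENNReal.ofReal (japaneseBracket (d - t) ^ (-p))) := by
        refine lintegral_mono fun t => ?_
        have h1 := japaneseBracket_pos (t + c)
        have h2 := japaneseBracket_pos (d - t)
        rw [← ENNReal.ofReal_add (by positivity) (by positivity),
          ← ENNReal.ofReal_mul (by positivity)]
        exact ENNReal.ofReal_le_ofReal (hpt t)
    _ = _ := by
        rw [lintegral_const_mul' _ _ ENNReal.ofReal_ne_top, lintegral_add_left (by fun_prop),
          lintegral_add_right_eq_self (fun t => ENNReal.ofReal (japaneseBracket t ^ (-p))) c,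
          lintegral_sub_left_eq_self (fun t => ENNReal.ofReal (japaneseBracket t ^ (-p))) d,
          ← two_mul, ← mul_assoc, show (2 : ℝ≥0∞) = ENNReal.ofReal 2 by simp,
          ← ENNReal.ofReal_mul (by positivity)]
        congr 2
        ring

theorem waveWeight_div_le {p a₀ a₁ a₂ ε₁ ε₂ : ℝ} (hp : 0 ≤ p) (h0 : 0 ≤ a₀) (h01 : a₀ ≤ a₁)
    (h02 : a₀ ≤ a₂) (hsum : 2 + p ≤ a₁ + a₂ - a₀) (t τ : ℝ) (x ξ : EuclideanSpace ℝ (Fin 3)) :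
    waveWeight a₀ p (WithLp.toLp 2 (τ, ξ)) / (signedWeight ε₁ a₁ p (WithLp.toLp 2 (t, x)) *
      signedWeight ε₂ a₂ p (WithLp.toLp 2 (τ, ξ) - WithLp.toLp 2 (t, x))) ≤
    2 ^ a₀ * 4 ^ p * (japaneseBracket ‖x‖ ^ (-(2 + p)) + japaneseBracket ‖ξ - x‖ ^ (-(2 + p))) *
      (japaneseBracket (t + ε₁ * ‖x‖) ^ (-p) +
        japaneseBracket ((τ + ε₂ * ‖ξ - x‖) - t) ^ (-p) +
        |(|ε₁ * ‖x‖ + ε₂ * ‖ξ - x‖| - ‖ξ‖)| ^ p * (japaneseBracket (t + ε₁ * ‖x‖) ^ (-p) *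
          japaneseBracket ((τ + ε₂ * ‖ξ - x‖) - t) ^ (-p))) := by
  have hA : japaneseBracket ‖ξ‖ ^ a₀ *
      (japaneseBracket ‖x‖ ^ (-a₁) * japaneseBracket ‖ξ - x‖ ^ (-a₂)) ≤ _ :=
    rpow_mul_rpow_neg_le (one_le_japaneseBracket _) (one_le_japaneseBracket _)
      (japaneseBracket_pos _).le (by
        refine le_trans (japaneseBracket_le_of_abs_le ?_) (japaneseBracket_add_le _ _)
        rw [abs_of_nonneg (by positivity), abs_of_nonneg (by positivity)]
        simpa using norm_add_le x (ξ - x)) h0 h01 h02 hsum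
  have hB := japaneseBracket_sub_rpow_le (τ := τ) (R := ‖ξ‖)
    (μ := ε₁ * ‖x‖ + ε₂ * ‖ξ - x‖) (l₁ := t + ε₁ * ‖x‖) (l₂ := (τ + ε₂ * ‖ξ - x‖) - t) hp
    (by ring)
  have h1 := japaneseBracket_pos ‖x‖
  have h2 := japaneseBracket_pos ‖ξ - x‖
  have h3 := japaneseBracket_pos (t + ε₁ * ‖x‖)
  have h4 := japaneseBracket_pos ((τ + ε₂ * ‖ξ - x‖) - t)
  have h5 := japaneseBracket_pos (|τ| - ‖ξ‖)
  have h6 := japaneseBracket_pos ‖ξ‖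
  calc _ = (japaneseBracket ‖ξ‖ ^ a₀ *
      (japaneseBracket ‖x‖ ^ (-a₁) * japaneseBracket ‖ξ - x‖ ^ (-a₂))) *
      (japaneseBracket (|τ| - ‖ξ‖) ^ p * (japaneseBracket (t + ε₁ * ‖x‖) ^ (-p) *
        japaneseBracket ((τ + ε₂ * ‖ξ - x‖) - t) ^ (-p))) := by
        simp only [waveWeight, signedWeight, WithLp.sub_fst, WithLp.sub_snd, WithLp.toLp_fst,
          WithLp.toLp_snd]
        rw [Real.rpow_neg h1.le, Real.rpow_neg h2.le, Real.rpow_neg h3.le, Real.rpow_neg h4.le,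
          show τ - t + ε₂ * ‖ξ - x‖ = (τ + ε₂ * ‖ξ - x‖) - t by ring]
        simp only [div_eq_mul_inv, mul_inv]
        ring
    _ ≤ _ := mul_le_mul hA hB (by positivity) (by positivity)
    _ = _ := by ring

theorem lintegral_spaceTime {f : SpaceTime → ℝ≥0∞} (hf : Measurable f) :
    ∫⁻ ζ, f ζ = ∫⁻ x : EuclideanSpace ℝ (Fin 3), ∫⁻ t : ℝ, f (WithLp.toLp 2 (t, x)) := by
  rw [← (WithLp.volume_preserving_toLp ℝ (EuclideanSpace ℝ (Fin 3))).lintegral_comp hf,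
    Measure.volume_eq_prod, lintegral_prod_symm]
  exact (hf.comp (WithLp.measurable_toLp 2 _)).aemeasurable

theorem ae_snd_ne_zero : ∀ᵐ ζ : SpaceTime, ζ.snd ≠ 0 := by
  rw [← (WithLp.volume_preserving_toLp ℝ (EuclideanSpace ℝ (Fin 3))).map_eq]
  rw [ae_map_iff (WithLp.measurable_toLp 2 _).aemeasurable]
  · have : ∀ᵐ x : EuclideanSpace ℝ (Fin 3), x ≠ 0 := Measure.ae_ne volume 0
    exact Measure.quasiMeasurePreserving_snd.ae this
  · exact (measurableSet_eq_fun (by fun_prop) (by fun_prop)).compl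

/-- The kernel bound: the ratio of the weights is uniformly integrable along `ζ₁ + ζ₂ = ζ`. -/
theorem lintegral_weight_ratio_le {p a₀ a₁ a₂ : ℝ} (hp : 1 < p) (h0 : 0 ≤ a₀) (h01 : a₀ ≤ a₁)
    (h02 : a₀ ≤ a₂) (hsum : 2 + p ≤ a₁ + a₂ - a₀) :
    ∃ C : ℝ≥0∞, C ≠ ∞ ∧ ∀ ε₁ ε₂ : ℝ, (ε₁ = 1 ∨ ε₁ = -1) → (ε₂ = 1 ∨ ε₂ = -1) →
      ∀ᵐ ζ : SpaceTime, ∫⁻ η, ENNReal.ofReal (waveWeight a₀ p ζ /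
        (signedWeight ε₁ a₁ p η * signedWeight ε₂ a₂ p (ζ - η))) ≤ C := by
  obtain ⟨D, hD, hres⟩ := lintegral_bracket_resonance_le hp
  have hp0 : 0 ≤ p := by linarith
  set I := ∫⁻ t, ENNReal.ofReal (japaneseBracket t ^ (-p)) with hI
  have hIfin : I ≠ ∞ := (lintegral_japaneseBracket_lt_top hp).ne
  set K := ∫⁻ x : EuclideanSpace ℝ (Fin 3), ENNReal.ofReal (japaneseBracket ‖x‖ ^ (-(2 + p)))
    with hK
  have hKfin : K ≠ ∞ :=
    (lintegral_japaneseBracket_norm_lt_top volume (by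
      rw [finrank_euclideanSpace_fin]
      push_cast
      linarith)).ne
  set c : ℝ := 2 ^ a₀ * 4 ^ p with hc
  have hc0 : 0 < c := by positivity
  refine ⟨ENNReal.ofReal c * (I + I) * (K + K) +
    ENNReal.ofReal (c * (2 ^ p * 2)) * I * (D + D), by finiteness, fun ε₁ ε₂ h₁ h₂ => ?_⟩
  -- Bipolar coordinates need two distinct foci; ξ = 0 is a null set of frequencies.
  filter_upwards [ae_snd_ne_zero] with ζ hζ
  obtain ⟨⟨τ, ξ⟩⟩ := ζ
  have hξ : ξ ≠ 0 := hζ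
  rw [lintegral_spaceTime (by fun_prop)]
  let m : EuclideanSpace ℝ (Fin 3) → ℝ := fun x => ε₁ * ‖x‖ + ε₂ * ‖ξ - x‖
  let β : EuclideanSpace ℝ (Fin 3) → ℝ := fun x => |(|m x| - ‖ξ‖)| ^ p
  let j₁ : EuclideanSpace ℝ (Fin 3) → ℝ := fun x => japaneseBracket ‖x‖ ^ (-(2 + p))
  let j₂ : EuclideanSpace ℝ (Fin 3) → ℝ := fun x => japaneseBracket ‖ξ - x‖ ^ (-(2 + p))
  let ω : EuclideanSpace ℝ (Fin 3) → ℝ := fun x => japaneseBracket (τ + m x) ^ (-p)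
  have hβ : ∀ x, 0 ≤ β x := fun x => Real.rpow_nonneg (abs_nonneg _) _
  have hj₁ : ∀ x, 0 ≤ j₁ x := fun x => Real.rpow_nonneg (japaneseBracket_pos _).le _
  have hj₂ : ∀ x, 0 ≤ j₂ x := fun x => Real.rpow_nonneg (japaneseBracket_pos _).le _
  have hω : ∀ x, 0 ≤ ω x := fun x => Real.rpow_nonneg (japaneseBracket_pos _).le _
  have time : ∀ x, ∫⁻ t : ℝ, ENNReal.ofReal (waveWeight a₀ p (WithLp.toLp 2 (τ, ξ)) /
      (signedWeight ε₁ a₁ p (WithLp.toLp 2 (t, x)) *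
        signedWeight ε₂ a₂ p (WithLp.toLp 2 (τ, ξ) - WithLp.toLp 2 (t, x)))) ≤
      ENNReal.ofReal c * (I + I) * (ENNReal.ofReal (j₁ x) + ENNReal.ofReal (j₂ x)) +
      ENNReal.ofReal (c * (2 ^ p * 2)) * I *
        (ENNReal.ofReal (j₁ x * β x * ω x) + ENNReal.ofReal (j₂ x * β x * ω x)) := by
    intro x
    have hN : 0 ≤ c * (j₁ x + j₂ x) := mul_nonneg hc0.le (add_nonneg (hj₁ x) (hj₂ x))
    calc _ ≤ ∫⁻ t : ℝ, ENNReal.ofReal (c * (j₁ x + j₂ x)) *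
          (ENNReal.ofReal (japaneseBracket (t + ε₁ * ‖x‖) ^ (-p)) +
          ENNReal.ofReal (japaneseBracket ((τ + ε₂ * ‖ξ - x‖) - t) ^ (-p)) +
          ENNReal.ofReal (β x) * ENNReal.ofReal (japaneseBracket (t + ε₁ * ‖x‖) ^ (-p) *
            japaneseBracket ((τ + ε₂ * ‖ξ - x‖) - t) ^ (-p))) := by
          refine lintegral_mono fun t => ?_
          have h3 := japaneseBracket_pos (t + ε₁ * ‖x‖)
          have h4 := japaneseBracket_pos ((τ + ε₂ * ‖ξ - x‖) - t)
          have h5 := hβ x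
          rw [← ENNReal.ofReal_mul h5, ← ENNReal.ofReal_add (by positivity) (by positivity),
            ← ENNReal.ofReal_add (by positivity) (by positivity), ← ENNReal.ofReal_mul hN]
          exact ENNReal.ofReal_le_ofReal
            (waveWeight_div_le hp0 h0 h01 h02 hsum t τ x ξ)
      _ = ENNReal.ofReal (c * (j₁ x + j₂ x)) * (I + I + ENNReal.ofReal (β x) *
          ∫⁻ t, ENNReal.ofReal (japaneseBracket (t + ε₁ * ‖x‖) ^ (-p) *
            japaneseBracket ((τ + ε₂ * ‖ξ - x‖) - t) ^ (-p))) := by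
          rw [lintegral_const_mul' _ _ ENNReal.ofReal_ne_top, lintegral_add_left (by fun_prop),
            lintegral_add_left (by fun_prop), lintegral_const_mul' _ _ ENNReal.ofReal_ne_top,
            lintegral_add_right_eq_self (fun t => ENNReal.ofReal (japaneseBracket t ^ (-p))),
            lintegral_sub_left_eq_self (fun t => ENNReal.ofReal (japaneseBracket t ^ (-p)))]
      _ ≤ ENNReal.ofReal (c * (j₁ x + j₂ x)) * (I + I + ENNReal.ofReal (β x) *
          (ENNReal.ofReal (2 ^ p * 2 * ω x) * I)) := by
          gcongr
          refine (lintegral_bracket_mul_bracket_le hp0 _ _).trans (le_of_eq ?_)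
          simp only [ω, m]
          rw [show τ + ε₂ * ‖ξ - x‖ + ε₁ * ‖x‖ = τ + (ε₁ * ‖x‖ + ε₂ * ‖ξ - x‖) by ring]
      _ = _ := by
          have h1 := hj₁ x
          have h2 := hj₂ x
          have h3 := hβ x
          have h4 := hω x
          rw [ENNReal.ofReal_mul hc0.le, ENNReal.ofReal_add h1 h2, ENNReal.ofReal_mul
            (by positivity : (0 : ℝ) ≤ 2 ^ p * 2), ENNReal.ofReal_mul hc0.le,
            ENNReal.ofReal_mul (by positivity : 0 ≤ j₁ x * β x),
            ENNReal.ofReal_mul (by positivity : 0 ≤ j₂ x * β x), ENNReal.ofReal_mul h1,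
            ENNReal.ofReal_mul h2]
          ring
  have int1 : ∫⁻ x, ENNReal.ofReal (j₁ x * β x * ω x) ≤ D := hres ε₁ ε₂ h₁ h₂ τ ξ hξ
  have int2 : ∫⁻ x, ENNReal.ofReal (j₂ x * β x * ω x) ≤ D := by
    -- The change x ↦ ξ - x exchanges the two factors, and with them the signs ε₁ and ε₂.
    rw [← lintegral_sub_left_eq_self _ ξ]
    refine le_trans (le_of_eq (lintegral_congr fun x => ?_)) (hres ε₂ ε₁ h₂ h₁ τ ξ hξ)
    simp only [j₂, β, ω, m, sub_sub_cancel]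
    rw [add_comm (ε₁ * ‖ξ - x‖)]
  have int3 : ∫⁻ x, ENNReal.ofReal (j₂ x) = K :=
    lintegral_sub_left_eq_self (fun x => ENNReal.ofReal (japaneseBracket ‖x‖ ^ (-(2 + p)))) ξ
  calc _ ≤ ∫⁻ x, (ENNReal.ofReal c * (I + I) * (ENNReal.ofReal (j₁ x) + ENNReal.ofReal (j₂ x)) +
      ENNReal.ofReal (c * (2 ^ p * 2)) * I *
        (ENNReal.ofReal (j₁ x * β x * ω x) + ENNReal.ofReal (j₂ x * β x * ω x))) :=
        lintegral_mono time
    _ = ENNReal.ofReal c * (I + I) * (K + K) + ENNReal.ofReal (c * (2 ^ p * 2)) * I *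
        ((∫⁻ x, ENNReal.ofReal (j₁ x * β x * ω x)) +
          ∫⁻ x, ENNReal.ofReal (j₂ x * β x * ω x)) := by
        rw [lintegral_add_left (by fun_prop), lintegral_const_mul' _ _ (by finiteness),
          lintegral_const_mul' _ _ (by finiteness), lintegral_add_left (by fun_prop),
          lintegral_add_left (by fun_prop), int3]
    _ ≤ _ := by gcongr

/-! ### From the kernel bound to the convolution estimate. -/

/-- A Schur-type bound for a bilinear convolution form with a kernel. -/
theorem lintegral_rpow_convolution_kernel_le {G : Type*} [AddCommGroup G] [MeasurableSpace G]
    [MeasurableAdd₂ G] [MeasurableNeg G] {μ : Measure G} [SFinite μ] [μ.IsAddLeftInvariant]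
    {r s : ℝ} (hrs : r.HolderConjugate s) {F H : G → ℝ≥0∞} {k : G → G → ℝ≥0∞}
    (hF : AEMeasurable F μ) (hH : AEMeasurable H μ) (hk : ∀ x, AEMeasurable (k x) μ) {C : ℝ≥0∞}
    (hC : ∀ᵐ x ∂μ, ∫⁻ y, k x y ^ r ∂μ ≤ C) :
    (∫⁻ x, (∫⁻ y, F y * H (x - y) * k x y ∂μ) ^ s ∂μ) ^ (1 / s) ≤
      C ^ (1 / r) * (∫⁻ x, F x ^ s ∂μ) ^ (1 / s) * (∫⁻ x, H x ^ s ∂μ) ^ (1 / s) := by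
  have hs : 0 < s := hrs.symm.pos
  have hr : 0 < r := hrs.pos
  have hHx : ∀ x, AEMeasurable (fun y => H (x - y)) μ := fun x =>
    hH.comp_quasiMeasurePreserving (quasiMeasurePreserving_sub_left_of_right_invariant μ x)
  have hjoint : AEMeasurable (fun p : G × G => F p.2 ^ s * H (p.1 - p.2) ^ s) (μ.prod μ) :=
    (hF.comp_snd.pow_const s).mul
      ((hH.comp_quasiMeasurePreserving
        (quasiMeasurePreserving_sub_of_right_invariant μ μ)).pow_const s)
  -- Hölder in y for fixed x puts the kernel in L^r; what remains is the convolution of F^s and H^s,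
  -- whose integral factors by translation invariance.
  have hpt : ∀ᵐ x ∂μ, (∫⁻ y, F y * H (x - y) * k x y ∂μ) ^ s ≤
      (∫⁻ y, F y ^ s * H (x - y) ^ s ∂μ) * C ^ (s / r) := by
    filter_upwards [hC] with x hx
    calc _ ≤ ((∫⁻ y, (F y * H (x - y)) ^ s ∂μ) ^ (1 / s) *
          (∫⁻ y, k x y ^ r ∂μ) ^ (1 / r)) ^ s := by
          gcongr
          exact ENNReal.lintegral_mul_le_Lp_mul_Lq μ hrs.symm (hF.mul (hHx x)) (hk x)
      _ ≤ ((∫⁻ y, (F y * H (x - y)) ^ s ∂μ) ^ (1 / s) * C ^ (1 / r)) ^ s := by gcongr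
      _ = _ := by
          rw [ENNReal.mul_rpow_of_nonneg _ _ hs.le, ← ENNReal.rpow_mul, ← ENNReal.rpow_mul,
            one_div_mul_cancel hs.ne', ENNReal.rpow_one]
          simp_rw [ENNReal.mul_rpow_of_nonneg _ _ hs.le]
          ring_nf
  have hint : ∫⁻ x, ∫⁻ y, F y ^ s * H (x - y) ^ s ∂μ ∂μ =
      (∫⁻ x, F x ^ s ∂μ) * ∫⁻ x, H x ^ s ∂μ := by
    rw [lintegral_lintegral_swap hjoint]
    have : ∀ y, ∫⁻ x, F y ^ s * H (x - y) ^ s ∂μ = F y ^ s * ∫⁻ x, H x ^ s ∂μ := by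
      intro y
      have hm : AEMeasurable (fun x => H (x - y)) μ :=
        hH.comp_quasiMeasurePreserving (measurePreserving_sub_right μ y).quasiMeasurePreserving
      rw [lintegral_const_mul'' _ (hm.pow_const s)]
      congr 1
      exact lintegral_sub_right_eq_self (fun x => H x ^ s) y
    simp_rw [this]
    rw [lintegral_mul_const'' _ (hF.pow_const s)]
  calc _ ≤ (∫⁻ x, (∫⁻ y, F y ^ s * H (x - y) ^ s ∂μ) * C ^ (s / r) ∂μ) ^ (1 / s) := by
        gcongr ?_ ^ _
        exact lintegral_mono_ae hpt
    _ = (((∫⁻ x, F x ^ s ∂μ) * ∫⁻ x, H x ^ s ∂μ) * C ^ (s / r)) ^ (1 / s) := by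
        rw [lintegral_mul_const'' _ hjoint.lintegral_prod_right', hint]
    _ = _ := by
        rw [ENNReal.mul_rpow_of_nonneg _ _ (by positivity),
          ENNReal.mul_rpow_of_nonneg _ _ (by positivity), ← ENNReal.rpow_mul,
          show s / r * (1 / s) = 1 / r by field_simp]
        ring

/-- The weighted convolution of the absolute values of two functions. -/
noncomputable def weightedAbsConv (w : SpaceTime → ℝ) (f g : SpaceTime → ℂ) (ζ : SpaceTime) :
    ℝ≥0∞ :=
  ENNReal.ofReal (w ζ) * ∫⁻ η, ‖f η‖ₑ * ‖g (ζ - η)‖ₑ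

theorem aemeasurable_weightedAbsConv {w : SpaceTime → ℝ} {f g : SpaceTime → ℂ}
    (hw : Measurable w) (hf : AEStronglyMeasurable f volume)
    (hg : AEStronglyMeasurable g volume) : AEMeasurable (weightedAbsConv w f g) := by
  refine AEMeasurable.mul (by fun_prop) ?_
  have : AEMeasurable (fun p : SpaceTime × SpaceTime => ‖f p.2‖ₑ * ‖g (p.1 - p.2)‖ₑ)
      (volume.prod volume) :=
    hf.enorm.comp_snd.mul (hg.enorm.comp_quasiMeasurePreserving
      (quasiMeasurePreserving_sub_of_right_invariant volume volume))
  exact this.lintegral_prod_right'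

theorem eLpNorm_conjExponent_eq {r : ℝ} (hr : 1 < r) {ε : Type*} [TopologicalSpace ε]
    [ContinuousENorm ε] (f : SpaceTime → ε) :
    eLpNorm f (ENNReal.ofReal (Real.conjExponent r)) volume =
      (∫⁻ ζ, ‖f ζ‖ₑ ^ Real.conjExponent r) ^ (1 / Real.conjExponent r) := by
  have h := (Real.HolderConjugate.conjExponent hr).symm.pos
  rw [eLpNorm_eq_lintegral_rpow_enorm_toReal (by simpa using h) ENNReal.ofReal_ne_top,
    ENNReal.toReal_ofReal h.le]

/-- The bilinear estimate on the Fourier side for fixed signs. -/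
theorem eLpNorm_weightedAbsConv_le {r b α₀ α₁ α₂ : ℝ} (hr : 1 < r) (hb : 1 / r < b)
    (h0 : 0 ≤ α₀) (h01 : α₀ ≤ α₁) (h02 : α₀ ≤ α₂) (hsum : 2 / r + b ≤ α₁ + α₂ - α₀) :
    ∃ C : ℝ≥0∞, C ≠ ∞ ∧ ∀ ε₁ ε₂ : ℝ, (ε₁ = 1 ∨ ε₁ = -1) → (ε₂ = 1 ∨ ε₂ = -1) →
      ∀ f g : SpaceTime → ℂ, AEStronglyMeasurable f volume → AEStronglyMeasurable g volume →
      eLpNorm (weightedAbsConv (waveWeight α₀ b) f g)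
        (ENNReal.ofReal (Real.conjExponent r)) volume ≤
      C * eLpNorm (fun ζ => (signedWeight ε₁ α₁ b ζ : ℂ) * f ζ)
          (ENNReal.ofReal (Real.conjExponent r)) volume *
        eLpNorm (fun ζ => (signedWeight ε₂ α₂ b ζ : ℂ) * g ζ)
          (ENNReal.ofReal (Real.conjExponent r)) volume := by
  have hr0 : 0 < r := by linarith
  -- The `r`-th power multiplies all exponents by r: b > 1/r becomes p > 1, and 2/r + b becomes 2 +
  -- p.
  obtain ⟨C, hC, hker⟩ := lintegral_weight_ratio_le (p := b * r) (a₀ := α₀ * r) (a₁ := α₁ * r)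
    (a₂ := α₂ * r) (by rwa [div_lt_iff₀ hr0] at hb) (by positivity) (by gcongr) (by gcongr) (by
      have := mul_le_mul_of_nonneg_right hsum hr0.le
      rw [add_mul, div_mul_cancel₀ _ hr0.ne'] at this
      linarith)
  refine ⟨C ^ (1 / r), ENNReal.rpow_ne_top_of_nonneg (by positivity) hC,
    fun ε₁ ε₂ h₁ h₂ f g hf hg => ?_⟩
  simp only [eLpNorm_conjExponent_eq hr]
  set k : SpaceTime → SpaceTime → ℝ≥0∞ := fun ζ η => ENNReal.ofReal (waveWeight α₀ b ζ /
    (signedWeight ε₁ α₁ b η * signedWeight ε₂ α₂ b (ζ - η))) with hk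
  have hkm : ∀ ζ, AEMeasurable (k ζ) volume := fun ζ => by
    refine Measurable.aemeasurable ?_
    simp only [hk]
    fun_prop
  have key := lintegral_rpow_convolution_kernel_le (Real.HolderConjugate.conjExponent hr)
    (F := fun ζ => ‖(signedWeight ε₁ α₁ b ζ : ℂ) * f ζ‖ₑ)
    (H := fun ζ => ‖(signedWeight ε₂ α₂ b ζ : ℂ) * g ζ‖ₑ) (k := k) (μ := volume) (C := C)
    (AEStronglyMeasurable.enorm (by fun_prop)) (AEStronglyMeasurable.enorm (by fun_prop)) hkm (by
      filter_upwards [hker ε₁ ε₂ h₁ h₂] with ζ hζ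
      refine le_trans (le_of_eq (lintegral_congr fun η => ?_)) hζ
      have p1 := waveWeight_pos α₀ b ζ
      have p2 := signedWeight_pos ε₁ α₁ b η
      have p3 := signedWeight_pos ε₂ α₂ b (ζ - η)
      rw [ENNReal.ofReal_rpow_of_nonneg (by positivity) hr0.le, Real.div_rpow p1.le
        (by positivity), Real.mul_rpow p2.le p3.le, waveWeight_rpow, signedWeight_rpow,
        signedWeight_rpow])
  refine le_trans (le_of_eq ?_) key
  congr 1
  refine lintegral_congr fun ζ => ?_
  rw [enorm_eq_self, weightedAbsConv, ← lintegral_const_mul' _ _ ENNReal.ofReal_ne_top]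
  congr 1
  refine lintegral_congr fun η => ?_
  have p1 := waveWeight_pos α₀ b ζ
  have p2 := signedWeight_pos ε₁ α₁ b η
  have p3 := signedWeight_pos ε₂ α₂ b (ζ - η)
  have e : ∀ {x : ℝ}, 0 < x → ‖(x : ℂ)‖ₑ = ENNReal.ofReal x := fun {x} hx => by
    rw [← ofReal_norm, Complex.norm_real, Real.norm_of_nonneg hx.le]
  rw [enorm_mul, enorm_mul, e p2, e p3]
  simp only [hk]
  have e2 : waveWeight α₀ b ζ = signedWeight ε₁ α₁ b η * signedWeight ε₂ α₂ b (ζ - η) *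
      (waveWeight α₀ b ζ / (signedWeight ε₁ α₁ b η * signedWeight ε₂ α₂ b (ζ - η))) := by
    field_simp
  conv_lhs => rw [e2]
  rw [ENNReal.ofReal_mul (by positivity), ENNReal.ofReal_mul p2.le]
  ring

/-! ### Distributions whose Fourier transform is a function. -/

namespace HasFourierFunction

variable {u v : 𝓢'(SpaceTime, ℂ)} {f g : SpaceTime → ℂ}

theorem locallyIntegrable (hf : HasFourierFunction u f) : LocallyIntegrable f volume := by
  intro x
  let φ : ContDiffBump x := ⟨1, 2, one_pos, one_lt_two⟩
  have h₁ : HasCompactSupport (Complex.ofRealCLM ∘ φ) := φ.hasCompactSupport.comp_left rfl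
  have h₂ : ContDiff ℝ (⊤ : ℕ∞) (Complex.ofRealCLM ∘ φ) :=
    Complex.ofRealCLM.contDiff.comp φ.contDiff
  refine ⟨Metric.closedBall x 1, Metric.closedBall_mem_nhds x one_pos, ?_⟩
  refine (hf.integrable (h₁.toSchwartzMap h₂)).integrableOn.congr_fun (fun ζ hζ => ?_)
    Metric.isClosed_closedBall.measurableSet
  simp [φ.one_of_mem_closedBall hζ]

/-- Locally integrable functions with equal integrals against smooth compactly supported functions
agree almost everywhere. Hence the infimum defining the norm is attained by every representative. -/
theorem ae_eq (hf : HasFourierFunction u f) (hg : HasFourierFunction u g) :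
    f =ᵐ[volume] g := by
  refine ae_eq_of_integral_contDiff_smul_eq hf.locallyIntegrable hg.locallyIntegrable
    fun φ hφ hφc => ?_
  have h₁ : HasCompactSupport (Complex.ofRealCLM ∘ φ) := hφc.comp_left rfl
  have h₂ : ContDiff ℝ (⊤ : ℕ∞) (Complex.ofRealCLM ∘ φ) := Complex.ofRealCLM.contDiff.comp hφ
  have := (hf.eq_integral (h₁.toSchwartzMap h₂)).symm.trans (hg.eq_integral (h₁.toSchwartzMap h₂))
  simpa using this

theorem add (hf : HasFourierFunction u f) (hg : HasFourierFunction v g) :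
    HasFourierFunction (u + v) (f + g) where
  aestronglyMeasurable := hf.aestronglyMeasurable.add hg.aestronglyMeasurable
  integrable φ := by
    simpa only [Pi.add_apply, mul_add] using! (hf.integrable φ).add (hg.integrable φ)
  eq_integral φ := by
    simp only [Pi.add_apply, mul_add]
    rw [integral_add (hf.integrable φ) (hg.integrable φ), ← hf.eq_integral, ← hg.eq_integral,
      FourierTransform.fourier_add]
    rfl

theorem fourierLebesgueNorm_eq (hf : HasFourierFunction u f) (r : ℝ) (w : SpaceTime → ℝ) :
    fourierLebesgueNorm r w u =
      eLpNorm (fun ζ => (w ζ : ℂ) * f ζ) (ENNReal.ofReal (Real.conjExponent r)) volume := by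
  refine le_antisymm (iInf₂_le f hf) (le_iInf₂ fun g hg => le_of_eq (eLpNorm_congr_ae ?_))
  filter_upwards [hf.ae_eq hg] with ζ hζ
  rw [hζ]

end HasFourierFunction

theorem exists_hasFourierFunction_of_norm_lt_top {r : ℝ} {w : SpaceTime → ℝ}
    {u : 𝓢'(SpaceTime, ℂ)} (h : fourierLebesgueNorm r w u < ∞) :
    ∃ f, HasFourierFunction u f := by
  by_contra! hne
  simp [fourierLebesgueNorm, hne] at h

theorem exists_hasFourierFunction_of_memLp {p : ℝ≥0∞} (hp : 1 ≤ p) {f : SpaceTime → ℂ}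
    (hf : MemLp f p volume) : ∃ u, HasFourierFunction u f := by
  have : Fact (1 ≤ p) := ⟨hp⟩
  refine ⟨𝓕⁻ (Lp.toTemperedDistribution hf.toLp), hf.1, fun φ => ?_, fun φ => ?_⟩
  · have := ENNReal.HolderConjugate.inv_one_sub_inv' hp
    exact memLp_one_iff_integrable.1 (hf.mul (φ.memLp (1 - p⁻¹)⁻¹))
  · rw [FourierTransform.fourier_fourierInv_eq, Lp.toTemperedDistribution_apply]
    refine integral_congr_ae ?_
    filter_upwards [hf.coeFn_toLp] with ζ hζ
    rw [hζ, smul_eq_mul]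

theorem SchwartzMap.hasFourierFunction (u : 𝓢(SpaceTime, ℂ)) :
    HasFourierFunction (u : 𝓢'(SpaceTime, ℂ)) (𝓕 u : 𝓢(SpaceTime, ℂ)) where
  aestronglyMeasurable := (𝓕 u : 𝓢(SpaceTime, ℂ)).continuous.aestronglyMeasurable
  integrable φ := (SchwartzMap.pairing (ContinuousLinearMap.mul ℂ ℂ) φ (𝓕 u)).integrable
  eq_integral φ := by
    rw [TemperedDistribution.fourier_toTemperedDistributionCLM_eq]
    simp

theorem SchwartzMap.fourier_fourier_apply (u : 𝓢(SpaceTime, ℂ)) (x : SpaceTime) :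
    (𝓕 (𝓕 u : 𝓢(SpaceTime, ℂ)) : 𝓢(SpaceTime, ℂ)) x = u (-x) := by
  have h : (𝓕⁻ (𝓕 u : 𝓢(SpaceTime, ℂ)) : 𝓢(SpaceTime, ℂ)) (-x) = u (-x) := by
    rw [FourierTransform.fourierInv_fourier_eq]
  rw [← h, SchwartzMap.fourierInv_coe, Real.fourierInv_eq_fourier_neg, neg_neg]
  rfl

/-- Transforming either side once more gives u(-y)v(-y), because a double Fourier transform is
reflection; Fourier inversion then removes the extra transform. -/
theorem SchwartzMap.fourier_mul_eq_convolution {u v w : 𝓢(SpaceTime, ℂ)}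
    (h : ∀ z, w z = u z * v z) (x : SpaceTime) :
    (𝓕 w : 𝓢(SpaceTime, ℂ)) x = ((𝓕 u : 𝓢(SpaceTime, ℂ))
      ⋆[ContinuousLinearMap.mul ℂ ℂ, volume] (𝓕 v : 𝓢(SpaceTime, ℂ))) x := by
  rw [← SchwartzMap.convolution_apply]
  have e : 𝓕 (SchwartzMap.convolution (ContinuousLinearMap.mul ℂ ℂ) (𝓕 u) (𝓕 v)) =
      𝓕 (𝓕 w : 𝓢(SpaceTime, ℂ)) := by
    rw [SchwartzMap.fourier_convolution]
    ext y
    simp only [SchwartzMap.pairing_apply_apply, SchwartzMap.fourier_fourier_apply, h]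
    rfl
  have inv : ∀ φ : 𝓢(SpaceTime, ℂ), 𝓕⁻ (𝓕 φ : 𝓢(SpaceTime, ℂ)) = φ := fun φ =>
    FourierTransform.fourierInv_fourier_eq φ
  rw [← inv (𝓕 w), ← e, inv]

/-! ### Summation over signs and existence of the product. -/

theorem weightedAbsConv_add_left_le (w : SpaceTime → ℝ) {f₁ f₂ g : SpaceTime → ℂ}
    (hf₁ : AEStronglyMeasurable f₁ volume) (hg : AEStronglyMeasurable g volume)
    (ζ : SpaceTime) :
    weightedAbsConv w (f₁ + f₂) g ζ ≤ weightedAbsConv w f₁ g ζ + weightedAbsConv w f₂ g ζ := by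
  have hm : AEMeasurable (fun η => ‖f₁ η‖ₑ * ‖g (ζ - η)‖ₑ) volume :=
    hf₁.enorm.mul (hg.enorm.comp_quasiMeasurePreserving
      (quasiMeasurePreserving_sub_left_of_right_invariant volume ζ))
  rw [weightedAbsConv, weightedAbsConv, weightedAbsConv, ← mul_add, ← lintegral_add_left' hm]
  gcongr with η
  rw [← add_mul]
  gcongr
  exact enorm_add_le _ _

theorem weightedAbsConv_add_right_le (w : SpaceTime → ℝ) {f g₁ g₂ : SpaceTime → ℂ}
    (hf : AEStronglyMeasurable f volume) (hg₁ : AEStronglyMeasurable g₁ volume)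
    (ζ : SpaceTime) :
    weightedAbsConv w f (g₁ + g₂) ζ ≤ weightedAbsConv w f g₁ ζ + weightedAbsConv w f g₂ ζ := by
  have hm : AEMeasurable (fun η => ‖f η‖ₑ * ‖g₁ (ζ - η)‖ₑ) volume :=
    hf.enorm.mul (hg₁.enorm.comp_quasiMeasurePreserving
      (quasiMeasurePreserving_sub_left_of_right_invariant volume ζ))
  rw [weightedAbsConv, weightedAbsConv, weightedAbsConv, ← mul_add, ← lintegral_add_left' hm]
  gcongr with η
  rw [← mul_add]
  gcongr
  exact enorm_add_le _ _

theorem eLpNorm_weightedAbsConv_add_le {w : SpaceTime → ℝ} (hw : Measurable w) {p : ℝ≥0∞}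
    (hp : 1 ≤ p) {f₁ f₂ g₁ g₂ : SpaceTime → ℂ}
    (hf₁ : AEStronglyMeasurable f₁ volume) (hf₂ : AEStronglyMeasurable f₂ volume)
    (hg₁ : AEStronglyMeasurable g₁ volume) (hg₂ : AEStronglyMeasurable g₂ volume) :
    eLpNorm (weightedAbsConv w (f₁ + f₂) (g₁ + g₂)) p volume ≤
      (eLpNorm (weightedAbsConv w f₁ g₁) p volume + eLpNorm (weightedAbsConv w f₁ g₂) p volume) +
      (eLpNorm (weightedAbsConv w f₂ g₁) p volume +
        eLpNorm (weightedAbsConv w f₂ g₂) p volume) := by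
  have hm : ∀ {f g : SpaceTime → ℂ}, AEStronglyMeasurable f volume →
      AEStronglyMeasurable g volume → AEStronglyMeasurable (weightedAbsConv w f g) volume :=
    fun hf hg => (aemeasurable_weightedAbsConv hw hf hg).aestronglyMeasurable
  have hright : ∀ f : SpaceTime → ℂ, AEStronglyMeasurable f volume →
      eLpNorm (weightedAbsConv w f (g₁ + g₂)) p volume ≤
      eLpNorm (weightedAbsConv w f g₁) p volume + eLpNorm (weightedAbsConv w f g₂) p volume :=
    fun f hf => (eLpNorm_mono_enorm fun ζ => weightedAbsConv_add_right_le w hf hg₁ ζ).trans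
      (eLpNorm_add_le (hm hf hg₁) (hm hf hg₂) hp)
  calc _ ≤ eLpNorm (weightedAbsConv w f₁ (g₁ + g₂)) p volume +
        eLpNorm (weightedAbsConv w f₂ (g₁ + g₂)) p volume :=
        (eLpNorm_mono_enorm fun ζ => weightedAbsConv_add_left_le w hf₁ (hg₁.add hg₂) ζ).trans
          (eLpNorm_add_le (hm hf₁ (hg₁.add hg₂)) (hm hf₂ (hg₁.add hg₂)) hp)
    _ ≤ _ := add_le_add (hright f₁ hf₁) (hright f₂ hf₂)

theorem enorm_mul_convolution_le {w : SpaceTime → ℝ} (f g : SpaceTime → ℂ)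
    {ζ : SpaceTime} (hw : 0 ≤ w ζ) :
    ‖(w ζ : ℂ) * (f ⋆[ContinuousLinearMap.mul ℂ ℂ, volume] g) ζ‖ₑ ≤ weightedAbsConv w f g ζ := by
  rw [enorm_mul, weightedAbsConv, ← ofReal_norm, Complex.norm_real, Real.norm_of_nonneg hw]
  gcongr
  refine (enorm_integral_le_lintegral_enorm _).trans (le_of_eq (lintegral_congr fun η => ?_))
  rw [ContinuousLinearMap.mul_apply', enorm_mul]

theorem aestronglyMeasurable_convolution {f g : SpaceTime → ℂ}
    (hf : AEStronglyMeasurable f volume) (hg : AEStronglyMeasurable g volume) :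
    AEStronglyMeasurable (f ⋆[ContinuousLinearMap.mul ℂ ℂ, volume] g) volume :=
  (hf.convolution_integrand (ContinuousLinearMap.mul ℂ ℂ) hg).integral_prod_right'

/-- A finite norm makes the weighted absolute convolution finite almost everywhere, and the positive
weight can be divided out. -/
theorem ae_convolutionExistsAt {w : SpaceTime → ℝ} (hw : ∀ ζ, 0 < w ζ) (hwm : Measurable w)
    {f g : SpaceTime → ℂ} (hf : AEStronglyMeasurable f volume)
    (hg : AEStronglyMeasurable g volume) {r : ℝ} (hr : 1 < r)
    (h : eLpNorm (weightedAbsConv w f g) (ENNReal.ofReal (Real.conjExponent r)) volume < ∞) :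
    ∀ᵐ ζ, ConvolutionExistsAt f g ζ (ContinuousLinearMap.mul ℂ ℂ) volume := by
  have hs := (Real.HolderConjugate.conjExponent hr).symm.pos
  rw [eLpNorm_conjExponent_eq hr, ENNReal.rpow_lt_top_iff_of_pos (by positivity)] at h
  filter_upwards [ae_lt_top' ((aemeasurable_weightedAbsConv hwm hf hg).enorm.pow_const _) h.ne]
    with ζ hζ
  rw [ENNReal.rpow_lt_top_iff_of_pos hs, enorm_eq_self, weightedAbsConv] at hζ
  refine ⟨hf.convolution_integrand_snd (ContinuousLinearMap.mul ℂ ℂ) hg ζ, ?_⟩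
  rw [hasFiniteIntegral_iff_enorm]
  simp only [ContinuousLinearMap.mul_apply', enorm_mul]
  by_contra htop
  rw [not_lt, top_le_iff] at htop
  rw [htop, ENNReal.mul_top (by simpa using hw ζ)] at hζ
  exact hζ.ne rfl

theorem lemma5p6 (r b α₀ α₁ α₂ : ℝ) (hr : 1 < r) (hr2 : r ≤ 2) (hb : 1 / r < b)
    (h0 : 0 ≤ α₀) (h01 : α₀ ≤ α₁) (h02 : α₀ ≤ α₂) (hsum : 2 / r + b ≤ α₁ + α₂ - α₀) :
    ∃ C : ℝ≥0, ∀ uPlus uMinus vPlus vMinus : 𝓢'(SpaceTime, ℂ),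
      xNorm r α₁ b uPlus uMinus < ∞ → xNorm r α₂ b vPlus vMinus < ∞ →
        -- the product exists in the wave-Sobolev space and satisfies the estimate
        (∃ w : 𝓢'(SpaceTime, ℂ), IsProduct (uPlus + uMinus) (vPlus + vMinus) w ∧
          waveNorm r α₀ b w ≤ C * xNorm r α₁ b uPlus uMinus * xNorm r α₂ b vPlus vMinus) ∧
        -- in particular the estimate holds for the pointwise product of Schwartz functions
        (∀ u v w : 𝓢(SpaceTime, ℂ), (u : 𝓢'(SpaceTime, ℂ)) = uPlus + uMinus →
          (v : 𝓢'(SpaceTime, ℂ)) = vPlus + vMinus → (∀ z, w z = u z * v z) →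
          waveNorm r α₀ b (w : 𝓢'(SpaceTime, ℂ)) ≤
            C * xNorm r α₁ b uPlus uMinus * xNorm r α₂ b vPlus vMinus) := by
  obtain ⟨C, hC, hbil⟩ := eLpNorm_weightedAbsConv_le hr hb h0 h01 h02 hsum
  have hb0 : 0 ≤ b := (by positivity : 0 ≤ 1 / r).trans hb.le
  have hp : 1 ≤ ENNReal.ofReal (Real.conjExponent r) :=
    ENNReal.one_le_ofReal.2 (Real.HolderConjugate.conjExponent hr).symm.lt.le
  refine ⟨C.toNNReal, fun uPlus uMinus vPlus vMinus hu hv => ?_⟩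
  rw [ENNReal.coe_toNNReal hC]
  have hu' := ENNReal.add_lt_top.1 hu
  have hv' := ENNReal.add_lt_top.1 hv
  obtain ⟨f₁, hf₁⟩ := exists_hasFourierFunction_of_norm_lt_top hu'.1
  obtain ⟨f₂, hf₂⟩ := exists_hasFourierFunction_of_norm_lt_top hu'.2
  obtain ⟨g₁, hg₁⟩ := exists_hasFourierFunction_of_norm_lt_top hv'.1
  obtain ⟨g₂, hg₂⟩ := exists_hasFourierFunction_of_norm_lt_top hv'.2
  have hf := hf₁.add hf₂
  have hg := hg₁.add hg₂
  have bound : eLpNorm (weightedAbsConv (waveWeight α₀ b) (f₁ + f₂) (g₁ + g₂))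
      (ENNReal.ofReal (Real.conjExponent r)) volume ≤
      C * xNorm r α₁ b uPlus uMinus * xNorm r α₂ b vPlus vMinus := by
    refine (eLpNorm_weightedAbsConv_add_le (measurable_waveWeight α₀ b) hp hf₁.1 hf₂.1 hg₁.1
      hg₂.1).trans ?_
    simp only [xNorm, xPlusNorm, xMinusNorm, hf₁.fourierLebesgueNorm_eq,
      hf₂.fourierLebesgueNorm_eq, hg₁.fourierLebesgueNorm_eq, hg₂.fourierLebesgueNorm_eq,
      plusWeight_eq, minusWeight_eq]
    -- The four sign pairs add up to the product of the two sums of norms, so the constant is that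
    -- of a single pair.
    refine (add_le_add
      (add_le_add (hbil 1 1 (.inl rfl) (.inl rfl) f₁ g₁ hf₁.1 hg₁.1)
        (hbil 1 (-1) (.inl rfl) (.inr rfl) f₁ g₂ hf₁.1 hg₂.1))
      (add_le_add (hbil (-1) 1 (.inr rfl) (.inl rfl) f₂ g₁ hf₂.1 hg₁.1)
        (hbil (-1) (-1) (.inr rfl) (.inr rfl) f₂ g₂ hf₂.1 hg₂.1))).trans (le_of_eq ?_)
    ring
  have waveBound : ∀ w : 𝓢'(SpaceTime, ℂ),
      HasFourierFunction w ((f₁ + f₂) ⋆[ContinuousLinearMap.mul ℂ ℂ, volume] (g₁ + g₂)) →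
      waveNorm r α₀ b w ≤ C * xNorm r α₁ b uPlus uMinus * xNorm r α₂ b vPlus vMinus := by
    intro w hw
    rw [waveNorm, hw.fourierLebesgueNorm_eq]
    exact (eLpNorm_mono_enorm fun ζ => enorm_mul_convolution_le _ _
      (waveWeight_pos α₀ b ζ).le).trans bound
  have hfin : eLpNorm (weightedAbsConv (waveWeight α₀ b) (f₁ + f₂) (g₁ + g₂))
      (ENNReal.ofReal (Real.conjExponent r)) volume < ∞ :=
    bound.trans_lt (ENNReal.mul_lt_top (ENNReal.mul_lt_top hC.lt_top hu) hv)
  refine ⟨?_, fun u v w hu2 hv2 hw => ?_⟩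
  -- Since the output weight is at least 1, the convolution itself lies in L^{r'} and so is the
  -- Fourier transform of a tempered distribution.
  · have hmem : MemLp ((f₁ + f₂) ⋆[ContinuousLinearMap.mul ℂ ℂ, volume] (g₁ + g₂))
        (ENNReal.ofReal (Real.conjExponent r)) volume := by
      refine ⟨aestronglyMeasurable_convolution hf.1 hg.1, lt_of_le_of_lt ?_ hfin⟩
      refine eLpNorm_mono_enorm fun ζ => ?_
      refine le_trans ?_ (enorm_mul_convolution_le _ _ (waveWeight_pos α₀ b ζ).le)
      rw [enorm_mul, ← ofReal_norm (waveWeight α₀ b ζ : ℂ), Complex.norm_real,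
        Real.norm_of_nonneg (waveWeight_pos α₀ b ζ).le]
      exact le_mul_of_one_le_left zero_le
        (ENNReal.one_le_ofReal.2 (one_le_waveWeight h0 hb0 ζ))
    obtain ⟨w, hw⟩ := exists_hasFourierFunction_of_memLp hp hmem
    exact ⟨w, ⟨_, _, hf, hg, ae_convolutionExistsAt (waveWeight_pos α₀ b)
      (measurable_waveWeight α₀ b) hf.1 hg.1 hr hfin, hw⟩, waveBound w hw⟩
  -- The Schwartz transforms agree almost everywhere with the chosen representatives, and
  -- convolution does not see null sets.
  · refine waveBound _ ?_
    have h₁ : (𝓕 u : 𝓢(SpaceTime, ℂ)) =ᵐ[volume] f₁ + f₂ :=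
      u.hasFourierFunction.ae_eq (hu2 ▸ hf)
    have h₂ : (𝓕 v : 𝓢(SpaceTime, ℂ)) =ᵐ[volume] g₁ + g₂ :=
      v.hasFourierFunction.ae_eq (hv2 ▸ hg)
    rw [← convolution_congr _ h₁ h₂]
    have := w.hasFourierFunction
    rwa [funext (SchwartzMap.fourier_mul_eq_convolution hw)] at this
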